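/- **Shape gradient of the piecewise constant Mumford–Shah energy.** Let $D\subseteq\mathbb R^2$ be a closed set of finite area, and let $\Omega\subset D$ be the bounded open region enclosed by a simple closed regular $C^2$ curve $\Gamma=\partial\Omega$, with $|D\setminus\Omega|>0$. Write $\Omega^c=D\setminus\Omega$, let $n$ be the outward unit normal of $\Omega$ on $\Gamma$, and let $H$ be the curvature of $\Gamma$ (signed so that $H=1/R$ if $\Omega$ is a disc of radius $R$). Let $f\in L^2(D)$ be a function that is continuous (relative to $D$) at every point of $\Gamma$, and let $\eta\in\mathbb R$. For a measurable set $S$ put $\mu(S)=\frac1{|S|}\int_S f\,dx$, and define $$E_1(\Omega)=\frac1{|\Omega|}\int_\Omega (f-\mu(\Omega))^2dx,\qquad E_2(\Omega)=\frac1{|\Omega^c|}\int_{\Omega^c}(f-\mu(\Omega^c))^2dx,\qquad E_3(\Omega)=\int_\Gamma d\Gamma,$$ $$E(\Omega)=E_1(\Omega)+E_2(\Omega)+\eta\,E_3(\Omega),$$ where $d\Gamma$ is the arc length, so that $E_3$ is the length of the boundary. Let $T_t:\mathbb R^2\to\mathbb R^2$, $t\in[0,\varepsilon)$, be a family of $C^1$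 diffeomorphisms with $T_0=\mathrm{id}$ and $\Omega_t=T_t(\Omega)\subset D$ for all $t$, such that $\partial_tT_t(x)$ exists, is $C^1$ in $x$, and is continuous in $(t,x)\in[0,\varepsilon)\times\mathbb R^2$ together with its derivative in $x$. Let $V(t,x)=(\partial_tT_t)(T_t^{-1}(x))$ be its Eulerian velocity field, and write $v_n=V(0)\cdot n$ on $\Gamma$. For a shape functional $J$ let $dJ(\Omega;V)=\lim_{t\downarrow0}\frac1t\big(J(\Omega_t)-J(\Omega)\big)$ be its Eulerian derivative. Then the Eulerian derivatives of $E_1,E_2,E_3$ and $E$ at $\Omega$ exist, and $$dE_i(\Omega;V)=\int_\Gamma \delta E_i\,v_n\,d\Gamma\quad(i=1,2,3),\qquad dE(\Omega;V)=\int_\Gamma\delta E\,v_n\,d\Gamma,$$ where, at $x\in\Gamma$, $$\delta E_1(x)=\frac{f(x)^2}{|\Omega|}-\frac1{|\Omega|^2}\Big(\int_\Omega f^2\,dy+2f(x)\int_\Omega f\,dy-\frac2{|\Omega|}\Big(\int_\Omega f\,dy\Big)^2\Big),$$ $$\delta E_2(x)=\frac1{|\Omega^c|^2}\Big(\int_{\Omega^c}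 f^2\,dy+2f(x)\int_{\Omega^c} f\,dy-\frac2{|\Omega^c|}\Big(\int_{\Omega^c} f\,dy\Big)^2\Big)-\frac{f(x)^2}{|\Omega^c|},$$ $$\delta E_3(x)=H(x),\qquad \delta E=\delta E_1+\delta E_2+\eta\,\delta E_3,$$ and $\delta E$ is continuous along $\Gamma$. -/

import Mathlib

open Set Filter Topology MeasureTheory

noncomputable section

namespace MumfordShah

/-- The Euclidean plane. -/
abbrev Plane : Type := EuclideanSpace ℝ (Fin 2)

/-! ### Boundary curves -/

/-- The unit normal to the right of a regular plane curve: the unit tangent turned by `-π/2`.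
It points out of a region that lies to the left of the curve. -/
def rightNormal (γ : ℝ → Plane) (s : ℝ) : Plane :=
  ‖deriv γ s‖⁻¹ • !₂[deriv γ s 1, -(deriv γ s 0)]

/-- The signed curvature `(x' y'' - y' x'') / |γ'|³` of a regular plane curve `γ = (x, y)`; it is
`1 / R` on a circle of radius `R` that is run through counterclockwise. -/
def curvature (γ : ℝ → Plane) (s : ℝ) : ℝ :=
  (deriv γ s 0 * deriv (deriv γ) s 1 - deriv γ s 1 * deriv (deriv γ) s 0) / ‖deriv γ s‖ ^ 3

/-- The integral `∫_Γ g dΓ` with respect to arc length over a closed curve `Γ` with the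
parametrization `γ` of period `ℓ`; the integrand is given as a function of the parameter. -/
def arcIntegral (γ : ℝ → Plane) (ℓ : ℝ) (g : ℝ → ℝ) : ℝ :=
  ∫ s in (0 : ℝ)..ℓ, g s * ‖deriv γ s‖

/-- `Ω` is the bounded open region enclosed by a simple closed regular `C²` curve, which `γ` runs
through once per period `ℓ`, with `Ω` to its left (so that `rightNormal γ` is the outward unit
normal of `Ω`). -/
structure IsJordanRegion (Ω : Set Plane) (γ : ℝ → Plane) (ℓ : ℝ) : Prop where
  isOpen : IsOpen Ω
  isBounded : Bornology.IsBounded Ω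
  period_pos : 0 < ℓ
  periodic : Function.Periodic γ ℓ
  contDiff : ContDiff ℝ 2 γ
  regular : ∀ s, deriv γ s ≠ 0
  simple : InjOn γ (Ico 0 ℓ)
  frontier_eq : frontier Ω = range γ
  outward : ∀ s, ∀ᶠ r in 𝓝[>] (0 : ℝ),
    γ s - r • rightNormal γ s ∈ Ω ∧ γ s + r • rightNormal γ s ∉ Ω

/-! ### Deformations and Eulerian derivatives -/

/-- The velocity `∂ₜ T_t(X)` at time `t ∈ [0, ε)` of the point that starts at `X`
(one-sided at `t = 0`). -/
def lagrangianVelocity (T : ℝ → Plane ≃ Plane) (ε : ℝ) (t : ℝ) (X : Plane) : Plane :=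
  derivWithin (fun s => T s X) (Ico 0 ε) t

/-- The Eulerian velocity field `V(t, x) = (∂ₜ T_t)(T_t⁻¹ x)`. -/
def eulerianVelocity (T : ℝ → Plane ≃ Plane) (ε : ℝ) (t : ℝ) (x : Plane) : Plane :=
  lagrangianVelocity T ε t ((T t).symm x)

/-- A family `T_t`, `t ∈ [0, ε)`, of `C¹` diffeomorphisms of the plane with `T_0 = id` which is
continuously differentiable in `t` with respect to `C¹` convergence on compact sets. -/
structure IsDeformation (T : ℝ → Plane ≃ Plane) (ε : ℝ) : Prop where
  pos : 0 < ε
  zero : ∀ x, T 0 x = x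
  contDiff : ∀ t ∈ Ico 0 ε, ContDiff ℝ 1 (T t)
  contDiff_symm : ∀ t ∈ Ico 0 ε, ContDiff ℝ 1 (T t).symm
  differentiableOn : ∀ X, DifferentiableOn ℝ (fun t => T t X) (Ico 0 ε)
  contDiff_velocity : ∀ t ∈ Ico 0 ε, ContDiff ℝ 1 (lagrangianVelocity T ε t)
  continuousOn_velocity :
    ContinuousOn (fun p : ℝ × Plane => lagrangianVelocity T ε p.1 p.2) (Ico 0 ε ×ˢ univ)
  continuousOn_fderiv_velocity :
    ContinuousOn (fun p : ℝ × Plane => fderiv ℝ (lagrangianVelocity T ε p.1) p.2)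
      (Ico 0 ε ×ˢ univ)

/-- The shape functional `J` has the Eulerian derivative `d = lim_{t ↓ 0} (J(T_t Ω) - J(Ω)) / t`
at `Ω` along the deformation `T`. -/
def HasEulerianDerivative (J : Set Plane → ℝ) (T : ℝ → Plane ≃ Plane) (Ω : Set Plane)
    (d : ℝ) : Prop :=
  Tendsto (fun t : ℝ => (J (T t '' Ω) - J Ω) / t) (𝓝[>] 0) (𝓝 d)

/-! ### The energy -/

/-- The mean `μ(S)` of `f` over `S`. -/
def mean (f : Plane → ℝ) (S : Set Plane) : ℝ :=
  1 / volume.real S * ∫ x in S, f x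

/-- The variance of `f` over `S`. -/
def regionVariance (f : Plane → ℝ) (S : Set Plane) : ℝ :=
  1 / volume.real S * ∫ x in S, (f x - mean f S) ^ 2

/-- The energy of the foreground. -/
def E₁ (f : Plane → ℝ) (Ω : Set Plane) : ℝ := regionVariance f Ω

/-- The energy of the background `D ∖ Ω`. -/
def E₂ (f : Plane → ℝ) (D Ω : Set Plane) : ℝ := regionVariance f (D \ Ω)

/-- The length of the boundary: its one-dimensional Hausdorff measure. -/
def E₃ (Ω : Set Plane) : ℝ := (Measure.hausdorffMeasure 1 : Measure Plane).real (frontier Ω)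

/-- The piecewise constant Mumford–Shah energy. -/
def energy (f : Plane → ℝ) (D : Set Plane) (η : ℝ) (Ω : Set Plane) : ℝ :=
  E₁ f Ω + E₂ f D Ω + η * E₃ Ω

/-! ### The shape gradient -/

/-- The shape gradient of `E₁` at the boundary point `x`. -/
def δE₁ (f : Plane → ℝ) (Ω : Set Plane) (x : Plane) : ℝ :=
  1 / volume.real Ω * f x ^ 2
    - 1 / volume.real Ω ^ 2 * ((∫ y in Ω, f y ^ 2) + 2 * f x * (∫ y in Ω, f y)
      - 2 / volume.real Ω * (∫ y in Ω, f y) ^ 2)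

/-- The shape gradient of `E₂` at the boundary point `x`. -/
def δE₂ (f : Plane → ℝ) (D Ω : Set Plane) (x : Plane) : ℝ :=
  1 / volume.real (D \ Ω) ^ 2 * ((∫ y in D \ Ω, f y ^ 2) + 2 * f x * (∫ y in D \ Ω, f y)
      - 2 / volume.real (D \ Ω) * (∫ y in D \ Ω, f y) ^ 2)
    - 1 / volume.real (D \ Ω) * f x ^ 2

/-- The shape gradient of the energy at the boundary point `γ s`; the length term contributes
`η` times the curvature. -/
def δE (f : Plane → ℝ) (D : Set Plane) (η : ℝ) (Ω : Set Plane) (γ : ℝ → Plane) (s : ℝ) : ℝ :=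
  δE₁ f Ω (γ s) + δE₂ f D Ω (γ s) + η * curvature γ s

/-- The normal velocity `v_n = V(0) · n` at the boundary point `γ s`. -/
def normalVelocity (T : ℝ → Plane ≃ Plane) (ε : ℝ) (γ : ℝ → Plane) (s : ℝ) : ℝ :=
  inner ℝ (eulerianVelocity T ε 0 (γ s)) (rightNormal γ s)

end MumfordShah

end

/-!
The variance of `f` over a set is a function of the area and of the integrals of `f` and `f ^ 2`,
so the first two energies are differentiated once `∫ x in T t '' Ω, g x` is, for `g` continuous at
`Γ`. As `g` is merely integrable away from `Γ`, a change of variables under `T t` is of no use.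
Instead one follows the layer between `Ω` and `T t '' Ω`: in the tubular coordinates
`(s, r) ↦ γ s + r • rightNormal γ s` of `Γ` it has thickness `t * normalVelocity T ε γ s + o(t)`,
and `g` is close to `g (γ s)` on it. The rescaling `r = t * ρ` therefore turns the difference
quotient into an integral that converges by dominated convergence.

The length of `T t '' Γ` is the integral of `‖fderiv ℝ (T t) (γ s) (deriv γ s)‖`. Its derivative is
the integral of the tangential derivative of the velocity along the unit tangent, which Frenet's
equation and an integration by parts turn into the integral of the curvature times the normal
velocity.
-/

namespace MumfordShah

/-! ### Preconnected sets and frontiers -/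

theorem inter_frontier_nonempty_of_isPreconnected {X : Type*} [TopologicalSpace X] {s U : Set X}
    (hs : IsPreconnected s) (hU : (s ∩ U).Nonempty) (hUc : (s \ U).Nonempty) :
    (s ∩ frontier U).Nonempty := by
  by_contra hempty
  rw [not_nonempty_iff_eq_empty, ← disjoint_iff_inter_eq_empty] at hempty
  obtain ⟨y, hys, hyU⟩ := hUc
  have hcover : s ⊆ interior U ∪ (closure U)ᶜ := fun z hz => by
    by_contra hz'
    simp only [mem_union, mem_compl_iff, not_or, not_not] at hz'
    exact disjoint_left.1 hempty hz ⟨hz'.2, hz'.1⟩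
  have hint : (s ∩ interior U).Nonempty := by
    obtain ⟨x, hxs, hxU⟩ := hU
    exact ⟨x, hxs, (hcover hxs).resolve_right fun h => h (subset_closure hxU)⟩
  have hext : (s ∩ (closure U)ᶜ).Nonempty :=
    ⟨y, hys, (hcover hys).resolve_left fun h => hyU (interior_subset h)⟩
  obtain ⟨z, -, hz, hz'⟩ :=
    hs _ _ isOpen_interior isClosed_closure.isOpen_compl hcover hint hext
  exact hz' (interior_subset_closure hz)

section Segment

variable {E : Type*} [NormedAddCommGroup E] [NormedSpace ℝ E]

theorem exists_mem_frontier_dist_le {U : Set E} {x y : E} (hx : x ∈ U) (hy : y ∉ U) :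
    ∃ z ∈ frontier U, dist z x ≤ dist x y ∧ dist z y ≤ dist x y := by
  obtain ⟨z, hz, hzU⟩ := inter_frontier_nonempty_of_isPreconnected
    (convex_segment (𝕜 := ℝ) x y).isPreconnected
    ⟨x, left_mem_segment ℝ x y, hx⟩ ⟨y, right_mem_segment ℝ x y, hy⟩
  refine ⟨z, hzU, ?_, ?_⟩ <;>
  · have := dist_add_dist_of_mem_segment hz
    linarith [dist_comm x z, dist_nonneg (x := x) (y := z), dist_nonneg (x := z) (y := y)]

theorem mem_image_ball_of_forall_dist_lt (e : E ≃ₜ E) {x : E} {r : ℝ} (hr : 0 < r)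
    (he : ∀ y ∈ Metric.closedBall x r, dist (e y) y < r / 2) : x ∈ e '' Metric.ball x r := by
  by_contra hx
  obtain ⟨z, hz, -, hzx⟩ :=
    exists_mem_frontier_dist_le (mem_image_of_mem e (Metric.mem_ball_self hr)) hx
  rw [← e.image_frontier] at hz
  obtain ⟨y, hy, rfl⟩ := hz
  have hyx : dist y x = r := Metric.frontier_ball_subset_sphere hy
  have := he y hyx.le
  have := he x (Metric.mem_closedBall_self hr.le)
  linarith [dist_triangle_left y x (e y)]

end Segment

/-! ### Differentiable families of maps -/

section Family

variable {E F : Type*} [NormedAddCommGroup F] {ε : ℝ}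

theorem eventually_forall_Icc_norm_sub_le [TopologicalSpace E] {w : ℝ → E → F} {K : Set E}
    (hε : 0 < ε) (hw : ContinuousOn (fun p : ℝ × E => w p.1 p.2) (Ico 0 ε ×ˢ univ))
    (hK : IsCompact K) {κ : ℝ} (hκ : 0 < κ) :
    ∀ᶠ t in 𝓝[>] 0, ∀ s ∈ Icc 0 t, s ∈ Ico 0 ε ∧ ∀ x ∈ K, ‖w s x - w 0 x‖ ≤ κ := by
  obtain ⟨v, hv, hvK⟩ := hK.mem_uniformity_of_prod (hw.mono (prod_mono_right (subset_univ K)))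
    (left_mem_Ico.2 hε) (Metric.dist_mem_uniformity hκ)
  have hv' : v ∩ Ico 0 ε ∈ 𝓝[≥] 0 := by
    rw [nhdsWithin_Ico_eq_nhdsGE hε] at hv
    exact inter_mem hv (Ico_mem_nhdsGE hε)
  obtain ⟨b, hb, hbv⟩ := mem_nhdsGE_iff_exists_Icc_subset.1 hv'
  filter_upwards [Ioc_mem_nhdsGT hb] with t ht s hs
  have hs' := hbv ⟨hs.1, hs.2.trans ht.2⟩
  exact ⟨hs'.2, fun x hx => (dist_eq_norm (w s x) (w 0 x)).symm.trans_le (hvK s hs'.1 x hx).le⟩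

variable [NormedSpace ℝ F]

theorem dist_inv_smul_le {a v : F} {t κ : ℝ} (ht : 0 < t) (ha : ‖a - t • v‖ ≤ κ * t) :
    dist v (t⁻¹ • a) ≤ κ := by
  rwa [dist_eq_norm', ← inv_smul_smul₀ ht.ne' v, ← smul_sub, norm_smul,
    Real.norm_of_nonneg (inv_nonneg.2 ht.le), inv_mul_le_iff₀ ht, mul_comm]

theorem norm_sub_sub_smul_le_of_hasDerivWithinAt {u u' : ℝ → F} {v : F} {t κ : ℝ} (ht : 0 ≤ t)
    (hu : ∀ s ∈ Icc 0 t, HasDerivWithinAt u (u' s) (Icc 0 t) s)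
    (hu' : ∀ s ∈ Icc 0 t, ‖u' s - v‖ ≤ κ) : ‖u t - u 0 - t • v‖ ≤ κ * t := by
  have hderiv : ∀ s ∈ Icc 0 t,
      HasDerivWithinAt (fun s => u s - s • v) (u' s - v) (Icc 0 t) s := fun s hs => by
    simpa only [one_smul, id] using
      (hu s hs).fun_sub ((hasDerivWithinAt_id s (Icc 0 t)).smul_const v)
  simpa [sub_right_comm, abs_of_nonneg ht] using
    (convex_Icc 0 t).norm_image_sub_le_of_norm_hasDerivWithin_le hderiv hu'
      (left_mem_Icc.2 ht) (right_mem_Icc.2 ht)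

section Topological

variable [TopologicalSpace E] {φ w : ℝ → E → F} {K : Set E}

theorem tendstoUniformlyOn_inv_smul_sub (hε : 0 < ε)
    (hφ : ∀ x, ∀ t ∈ Ico 0 ε, HasDerivWithinAt (fun s => φ s x) (w t x) (Ico 0 ε) t)
    (hw : ContinuousOn (fun p : ℝ × E => w p.1 p.2) (Ico 0 ε ×ˢ univ)) (hK : IsCompact K) :
    TendstoUniformlyOn (fun t x => t⁻¹ • (φ t x - φ 0 x)) (w 0) (𝓝[>] 0) K := by
  rw [Metric.tendstoUniformlyOn_iff]
  intro κ hκ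
  filter_upwards [self_mem_nhdsWithin, eventually_forall_Icc_norm_sub_le hε hw hK (half_pos hκ)]
    with t (ht : 0 < t) hwt x hx
  refine (dist_inv_smul_le ht ?_).trans_lt (half_lt_self hκ)
  exact norm_sub_sub_smul_le_of_hasDerivWithinAt ht.le
    (fun s hs => (hφ x s (hwt s hs).1).mono fun r hr => (hwt r hr).1)
    fun s hs => (hwt s hs).2 x hx

theorem exists_forall_norm_le_mul_of_tendstoUniformlyOn {a : ℝ → E → F} {v : E → F}
    (hK : IsCompact K) (hv : ContinuousOn v K)
    (ha : TendstoUniformlyOn (fun t x => t⁻¹ • a t x) v (𝓝[>] 0) K) :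
    ∃ C > 0, ∀ᶠ t in 𝓝[>] 0, ∀ x ∈ K, ‖a t x‖ ≤ C * t := by
  obtain ⟨M, hM⟩ := hK.exists_bound_of_continuousOn hv
  refine ⟨|M| + 1, by positivity, ?_⟩
  filter_upwards [self_mem_nhdsWithin, Metric.tendstoUniformlyOn_iff.1 ha 1 one_pos]
    with t (ht : 0 < t) hdist x hx
  have hquot : ‖t⁻¹ • a t x‖ ≤ |M| + 1 := by
    have := hdist x hx
    rw [dist_eq_norm'] at this
    linarith [norm_le_norm_add_norm_sub' (t⁻¹ • a t x) (v x), hM x hx, le_abs_self M]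
  rwa [norm_smul, Real.norm_of_nonneg (inv_nonneg.2 ht.le), inv_mul_le_iff₀ ht, mul_comm]
    at hquot

end Topological

section Normed

variable [NormedAddCommGroup E] [NormedSpace ℝ E] [ProperSpace E] {φ w : ℝ → E → F}

theorem eventually_norm_sub_sub_smul_fderiv_le (hε : 0 < ε)
    (hφ : ∀ x, ∀ t ∈ Ico 0 ε, HasDerivWithinAt (fun s => φ s x) (w t x) (Ico 0 ε) t)
    (hφd : ∀ t ∈ Ico 0 ε, Differentiable ℝ (φ t)) (hwd : ∀ t ∈ Ico 0 ε, Differentiable ℝ (w t))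
    (hw' : ContinuousOn (fun p : ℝ × E => fderiv ℝ (w p.1) p.2) (Ico 0 ε ×ˢ univ))
    (R : ℝ) {κ : ℝ} (hκ : 0 < κ) :
    ∀ᶠ t in 𝓝[>] 0, ∀ x ∈ Metric.ball 0 R,
      ‖fderiv ℝ (φ t) x - fderiv ℝ (φ 0) x - t • fderiv ℝ (w 0) x‖ ≤ κ * t := by
  have h0 : (0 : ℝ) ∈ Ico 0 ε := left_mem_Ico.2 hε
  filter_upwards [self_mem_nhdsWithin, eventually_forall_Icc_norm_sub_le
    (w := fun t => fderiv ℝ (w t)) hε hw' (isCompact_closedBall (0 : E) R) hκ]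
    with t (ht : 0 < t) hwt x hx
  have hvel : ∀ s ∈ Icc 0 t, ∀ y ∈ Metric.ball 0 R, ∀ z ∈ Metric.ball 0 R,
      ‖w s y - w s z - (w 0 y - w 0 z)‖ ≤ κ * ‖y - z‖ := fun s hs y hy z hz => by
    have := (convex_ball (0 : E) R).norm_image_sub_le_of_norm_fderiv_le (𝕜 := ℝ)
      (f := w s - w 0) (fun z _ => (hwd s (hwt s hs).1 z).sub (hwd 0 h0 z))
      (fun z hz => by
        rw [fderiv_sub (hwd s (hwt s hs).1 z) (hwd 0 h0 z)]
        exact (hwt s hs).2 z (Metric.ball_subset_closedBall hz)) hz hy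
    simpa [sub_sub_sub_comm] using this
  have hlip : LipschitzOnWith (κ * t).toNNReal (φ t - φ 0 - t • w 0) (Metric.ball 0 R) := by
    refine LipschitzOnWith.of_dist_le_mul fun y hy z hz => ?_
    have := norm_sub_sub_smul_le_of_hasDerivWithinAt (u := fun s => φ s y - φ s z) ht.le
      (fun s hs => ((hφ y s (hwt s hs).1).sub (hφ z s (hwt s hs).1)).mono
        fun r hr => (hwt r hr).1) fun s hs => hvel s hs y hy z hz
    rw [Real.coe_toNNReal _ (by positivity), dist_eq_norm, dist_eq_norm]
    convert this using 1
    · simp only [Pi.sub_apply, Pi.smul_apply, smul_sub]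
      congr 1
      abel
    · ring
  have hderiv := ((hφd t (hwt t (right_mem_Icc.2 ht.le)).1 x).hasFDerivAt.sub
    (hφd 0 h0 x).hasFDerivAt).sub ((hwd 0 h0 x).hasFDerivAt.const_smul t)
  simpa [ht.le, hκ.le, mul_nonneg] using
    hderiv.le_of_lipschitzOn (Metric.isOpen_ball.mem_nhds hx) hlip

theorem tendstoUniformlyOn_inv_smul_fderiv_sub {K : Set E} (hε : 0 < ε)
    (hφ : ∀ x, ∀ t ∈ Ico 0 ε, HasDerivWithinAt (fun s => φ s x) (w t x) (Ico 0 ε) t)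
    (hφd : ∀ t ∈ Ico 0 ε, Differentiable ℝ (φ t)) (hwd : ∀ t ∈ Ico 0 ε, Differentiable ℝ (w t))
    (hw' : ContinuousOn (fun p : ℝ × E => fderiv ℝ (w p.1) p.2) (Ico 0 ε ×ˢ univ))
    (hK : Bornology.IsBounded K) :
    TendstoUniformlyOn (fun t x => t⁻¹ • (fderiv ℝ (φ t) x - fderiv ℝ (φ 0) x))
      (fderiv ℝ (w 0)) (𝓝[>] 0) K := by
  obtain ⟨R, hR⟩ := hK.subset_ball 0
  rw [Metric.tendstoUniformlyOn_iff]
  intro κ hκ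
  filter_upwards [self_mem_nhdsWithin,
    eventually_norm_sub_sub_smul_fderiv_le hε hφ hφd hwd hw' R (half_pos hκ)]
    with t (ht : 0 < t) hle x hx
  exact (dist_inv_smul_le ht (hle x (hR hx))).trans_lt (half_lt_self hκ)

end Normed

end Family

/-! ### Deformations at time zero -/

namespace IsDeformation

variable {T : ℝ → Plane ≃ Plane} {ε : ℝ}

theorem zero_mem (hT : IsDeformation T ε) : (0 : ℝ) ∈ Ico 0 ε := left_mem_Ico.2 hT.pos

theorem eventually_mem_Ico (hT : IsDeformation T ε) : ∀ᶠ t in 𝓝[>] (0 : ℝ), t ∈ Ico 0 ε :=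
  mem_of_superset (Ioo_mem_nhdsGT hT.pos) Ioo_subset_Ico_self

theorem coe_zero (hT : IsDeformation T ε) : ⇑(T 0) = id := funext hT.zero

theorem coe_symm_zero (hT : IsDeformation T ε) : ⇑(T 0).symm = id :=
  funext fun x => by rw [Equiv.symm_apply_eq, hT.zero, id]

theorem eulerianVelocity_zero (hT : IsDeformation T ε) :
    eulerianVelocity T ε 0 = lagrangianVelocity T ε 0 :=
  funext fun x => by rw [eulerianVelocity, hT.coe_symm_zero, id]

/-- The diffeomorphism `T_t`, as a homeomorphism. -/
def homeomorph (hT : IsDeformation T ε) {t : ℝ} (ht : t ∈ Ico 0 ε) : Plane ≃ₜ Plane where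
  toEquiv := T t
  continuous_toFun := (hT.contDiff t ht).continuous
  continuous_invFun := (hT.contDiff_symm t ht).continuous

theorem coe_homeomorph (hT : IsDeformation T ε) {t : ℝ} (ht : t ∈ Ico 0 ε) :
    ⇑(hT.homeomorph ht) = T t := rfl

theorem frontier_image (hT : IsDeformation T ε) {t : ℝ} (ht : t ∈ Ico 0 ε) (S : Set Plane) :
    frontier (T t '' S) = T t '' frontier S :=
  ((hT.homeomorph ht).image_frontier S).symm

theorem isOpen_image (hT : IsDeformation T ε) {t : ℝ} (ht : t ∈ Ico 0 ε) {S : Set Plane}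
    (hS : IsOpen S) : IsOpen (T t '' S) :=
  (hT.homeomorph ht).isOpenMap S hS

theorem hasDerivWithinAt (hT : IsDeformation T ε) (x : Plane) {t : ℝ} (ht : t ∈ Ico 0 ε) :
    HasDerivWithinAt (fun s => T s x) (lagrangianVelocity T ε t x) (Ico 0 ε) t :=
  (hT.differentiableOn x t ht).hasDerivWithinAt

theorem contDiff_velocity_zero (hT : IsDeformation T ε) :
    ContDiff ℝ 1 (lagrangianVelocity T ε 0) := hT.contDiff_velocity 0 hT.zero_mem

theorem tendstoUniformlyOn_inv_smul_sub (hT : IsDeformation T ε) {K : Set Plane}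
    (hK : IsCompact K) :
    TendstoUniformlyOn (fun t x => t⁻¹ • (T t x - x)) (lagrangianVelocity T ε 0) (𝓝[>] 0) K := by
  simpa only [hT.zero] using MumfordShah.tendstoUniformlyOn_inv_smul_sub (φ := fun t x => T t x)
    hT.pos (fun x _ ht => hT.hasDerivWithinAt x ht) hT.continuousOn_velocity hK

theorem tendstoUniformlyOn_inv_smul_fderiv_sub (hT : IsDeformation T ε) {K : Set Plane}
    (hK : IsCompact K) :
    TendstoUniformlyOn (fun t x => t⁻¹ • (fderiv ℝ (T t) x - .id ℝ Plane))
      (fderiv ℝ (lagrangianVelocity T ε 0)) (𝓝[>] 0) K := by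
  simpa only [hT.coe_zero, fderiv_id] using
    MumfordShah.tendstoUniformlyOn_inv_smul_fderiv_sub (φ := fun t x => T t x)
      hT.pos (fun x _ ht => hT.hasDerivWithinAt x ht)
      (fun t ht => (hT.contDiff t ht).differentiable one_ne_zero)
      (fun t ht => (hT.contDiff_velocity t ht).differentiable one_ne_zero)
      hT.continuousOn_fderiv_velocity hK.isBounded

theorem exists_forall_norm_sub_le (hT : IsDeformation T ε) {K : Set Plane} (hK : IsCompact K) :
    ∃ C > 0, ∀ᶠ t in 𝓝[>] (0 : ℝ), ∀ x ∈ K, ‖T t x - x‖ ≤ C * t :=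
  exists_forall_norm_le_mul_of_tendstoUniformlyOn hK
    hT.contDiff_velocity_zero.continuous.continuousOn (hT.tendstoUniformlyOn_inv_smul_sub hK)

theorem exists_forall_norm_fderiv_sub_le (hT : IsDeformation T ε) {K : Set Plane}
    (hK : IsCompact K) :
    ∃ C > 0, ∀ᶠ t in 𝓝[>] (0 : ℝ), ∀ x ∈ K, ‖fderiv ℝ (T t) x - .id ℝ Plane‖ ≤ C * t :=
  exists_forall_norm_le_mul_of_tendstoUniformlyOn hK
    (hT.contDiff_velocity_zero.continuous_fderiv one_ne_zero).continuousOn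
    (hT.tendstoUniformlyOn_inv_smul_fderiv_sub hK)

theorem exists_forall_norm_symm_sub_le (hT : IsDeformation T ε) {K : Set Plane}
    (hK : IsCompact K) :
    ∃ C > 0, ∀ᶠ t in 𝓝[>] (0 : ℝ), ∀ x ∈ K, ‖(T t).symm x - x‖ ≤ C * t := by
  obtain ⟨C, hC, hmove⟩ := hT.exists_forall_norm_sub_le (hK.cthickening (r := 1))
  refine ⟨C, hC, ?_⟩
  filter_upwards [hmove, hT.eventually_mem_Ico, Ioo_mem_nhdsGT (one_div_pos.2 (mul_pos two_pos hC))]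
    with t hmove ht htC x hx
  have hCt : C * t < 1 / 2 := by
    have := (lt_div_iff₀ (mul_pos two_pos hC)).1 htC.2
    linarith
  have hball : Metric.closedBall x 1 ⊆ Metric.cthickening 1 K :=
    Metric.closedBall_subset_cthickening hx 1
  obtain ⟨y, hy, hyx⟩ := mem_image_ball_of_forall_dist_lt (hT.homeomorph ht) one_pos fun y hy =>
    (dist_eq_norm (T t y) y).trans_lt ((hmove y (hball hy)).trans_lt hCt)
  rw [← hyx, coe_homeomorph, Equiv.symm_apply_apply, norm_sub_rev]
  exact hmove y (hball (Metric.ball_subset_closedBall hy))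

theorem tendsto_symm (hT : IsDeformation T ε) {x : ℝ → Plane} {x₀ : Plane}
    (hx : Tendsto x (𝓝[>] 0) (𝓝 x₀)) :
    Tendsto (fun t => (T t).symm (x t)) (𝓝[>] 0) (𝓝 x₀) := by
  obtain ⟨C, -, hC⟩ := hT.exists_forall_norm_symm_sub_le (isCompact_closedBall x₀ 1)
  have hlim : Tendsto (fun t : ℝ => C * t) (𝓝[>] 0) (𝓝 0) :=
    tendsto_nhdsWithin_of_tendsto_nhds (by simpa using (continuous_const_mul C).tendsto 0)
  have hdiff : Tendsto (fun t => (T t).symm (x t) - x t) (𝓝[>] 0) (𝓝 0) := by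
    refine squeeze_zero_norm' ?_ hlim
    filter_upwards [hC, hx.eventually_mem (Metric.closedBall_mem_nhds x₀ one_pos)] with t ht hxt
    exact ht (x t) hxt
  simpa using hdiff.add hx

theorem hasDerivWithinAt_symm (hT : IsDeformation T ε) {x : ℝ → Plane} {x' : Plane}
    (hx : HasDerivWithinAt x x' (Ioi 0) 0) :
    HasDerivWithinAt (fun t => (T t).symm (x t)) (x' - lagrangianVelocity T ε 0 (x 0))
      (Ioi 0) 0 := by
  have hy := hT.tendsto_symm hx.continuousWithinAt
  have hnhds : Metric.closedBall (x 0) 1 ∈ 𝓝 (x 0) := Metric.closedBall_mem_nhds (x 0) one_pos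
  have hquot : Tendsto (fun t => t⁻¹ • (T t ((T t).symm (x t)) - (T t).symm (x t))) (𝓝[>] 0)
      (𝓝 (lagrangianVelocity T ε 0 (x 0))) :=
    (hT.tendstoUniformlyOn_inv_smul_sub (isCompact_closedBall (x 0) 1)).tendsto_comp
      hT.contDiff_velocity_zero.continuous.continuousWithinAt
      (tendsto_nhdsWithin_iff.2 ⟨hy, hy.eventually_mem hnhds⟩)
  rw [hasDerivWithinAt_iff_tendsto_slope' self_notMem_Ioi] at hx ⊢
  refine (hx.sub hquot).congr fun t => ?_
  simp only [slope_def_module, sub_zero, Equiv.apply_symm_apply, hT.coe_symm_zero, id, ← smul_sub]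
  congr 1
  abel

end IsDeformation

/-! ### The moving frame of a regular plane curve -/

theorem inner_plane (v w : Plane) : inner ℝ v w = v 0 * w 0 + v 1 * w 1 := by
  simp [PiLp.inner_apply, Fin.sum_univ_two, mul_comm]

theorem norm_sq_plane (v : Plane) : ‖v‖ ^ 2 = v 0 ^ 2 + v 1 ^ 2 := by
  rw [← real_inner_self_eq_norm_sq, inner_plane]; ring

theorem contDiff_plane_mk {E : Type*} [NormedAddCommGroup E] [NormedSpace ℝ E] {n : WithTop ℕ∞}
    {a b : E → ℝ} (ha : ContDiff ℝ n a) (hb : ContDiff ℝ n b) :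
    ContDiff ℝ n fun x => (!₂[a x, b x] : Plane) := by
  rw [contDiff_euclidean, Fin.forall_fin_two]
  exact ⟨ha, hb⟩

section Frame

variable {γ : ℝ → Plane} {s : ℝ}

theorem rightNormal_apply_zero (γ : ℝ → Plane) (s : ℝ) :
    rightNormal γ s 0 = ‖deriv γ s‖⁻¹ * deriv γ s 1 := by simp [rightNormal]

theorem rightNormal_apply_one (γ : ℝ → Plane) (s : ℝ) :
    rightNormal γ s 1 = -(‖deriv γ s‖⁻¹ * deriv γ s 0) := by simp [rightNormal]

theorem inner_deriv_rightNormal (γ : ℝ → Plane) (s : ℝ) :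
    inner ℝ (deriv γ s) (rightNormal γ s) = 0 := by
  rw [inner_plane, rightNormal_apply_zero, rightNormal_apply_one]
  ring

theorem norm_rightNormal (h : deriv γ s ≠ 0) : ‖rightNormal γ s‖ = 1 := by
  have hpos : ‖deriv γ s‖ ≠ 0 := norm_ne_zero_iff.2 h
  refine (pow_eq_one_iff_of_nonneg (norm_nonneg _) two_ne_zero).1 ?_
  rw [norm_sq_plane, rightNormal_apply_zero, rightNormal_apply_one]
  field_simp
  rw [norm_sq_plane]
  ring

theorem eq_tangential_add_normal (h : deriv γ s ≠ 0) (v : Plane) :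
    (inner ℝ v (deriv γ s) / ‖deriv γ s‖ ^ 2) • deriv γ s
      + (inner ℝ v (rightNormal γ s) : ℝ) • rightNormal γ s = v := by
  have hpos : ‖deriv γ s‖ ≠ 0 := norm_ne_zero_iff.2 h
  ext i
  fin_cases i <;>
  · simp only [inner_plane, rightNormal_apply_zero, rightNormal_apply_one, PiLp.add_apply,
      PiLp.smul_apply, smul_eq_mul, Fin.zero_eta, Fin.mk_one]
    field_simp
    rw [norm_sq_plane (deriv γ s)]
    ring

/-- The coordinates `(a, b) ↦ a γ'(s) + b n(s)` of the moving frame. -/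
noncomputable def frameEquiv (h : deriv γ s ≠ 0) : (ℝ × ℝ) ≃L[ℝ] Plane :=
  ContinuousLinearEquiv.equivOfInverse
    ((ContinuousLinearMap.fst ℝ ℝ ℝ).smulRight (deriv γ s)
      + (ContinuousLinearMap.snd ℝ ℝ ℝ).smulRight (rightNormal γ s))
    (((‖deriv γ s‖ ^ 2)⁻¹ • innerSL ℝ (deriv γ s)).prod (innerSL ℝ (rightNormal γ s)))
    (fun p => by
      have hpos : ‖deriv γ s‖ ≠ 0 := norm_ne_zero_iff.2 h
      ext
      · simp [inner_add_right, inner_smul_right, inner_deriv_rightNormal]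
        field_simp
      · have horth : inner ℝ (rightNormal γ s) (deriv γ s) = 0 :=
          (real_inner_comm _ _).trans (inner_deriv_rightNormal γ s)
        simp [inner_add_right, inner_smul_right, horth, norm_rightNormal h])
    (fun v => by
      simpa [real_inner_comm, div_eq_inv_mul] using eq_tangential_add_normal h v)

theorem frameEquiv_apply (h : deriv γ s ≠ 0) (p : ℝ × ℝ) :
    frameEquiv h p = p.1 • deriv γ s + p.2 • rightNormal γ s := rfl

theorem frameEquiv_symm_apply_snd (h : deriv γ s ≠ 0) (v : Plane) :
    ((frameEquiv h).symm v).2 = inner ℝ v (rightNormal γ s) :=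
  real_inner_comm v (rightNormal γ s)

end Frame

section RegularCurve

variable {γ : ℝ → Plane}

theorem periodic_deriv {E : Type*} [NormedAddCommGroup E] [NormedSpace ℝ E] {c : ℝ → E} {ℓ : ℝ}
    (hc : Function.Periodic c ℓ) : Function.Periodic (deriv c) ℓ := fun s => by
  rw [← deriv_comp_add_const, funext hc]

theorem periodic_rightNormal {ℓ : ℝ} (hγ : Function.Periodic γ ℓ) :
    Function.Periodic (rightNormal γ) ℓ := fun s => by
  simp only [rightNormal, periodic_deriv hγ s]

theorem hasDerivAt_of_contDiff_two {E : Type*} [NormedAddCommGroup E] [NormedSpace ℝ E]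
    {c : ℝ → E} (hc : ContDiff ℝ 2 c) (s : ℝ) : HasDerivAt c (deriv c s) s :=
  (hc.differentiable two_ne_zero s).hasDerivAt

theorem contDiff_deriv {E : Type*} [NormedAddCommGroup E] [NormedSpace ℝ E]
    {c : ℝ → E} (hc : ContDiff ℝ 2 c) : ContDiff ℝ 1 (deriv c) :=
  ContDiff.deriv' (by simpa [one_add_one_eq_two] using hc)

theorem contDiff_norm_deriv (hγ : ContDiff ℝ 2 γ) (hreg : ∀ s, deriv γ s ≠ 0) :
    ContDiff ℝ 1 fun s => ‖deriv γ s‖ :=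
  (contDiff_deriv hγ).norm ℝ hreg

theorem contDiff_rightNormal (hγ : ContDiff ℝ 2 γ) (hreg : ∀ s, deriv γ s ≠ 0) :
    ContDiff ℝ 1 (rightNormal γ) :=
  have hcoord := contDiff_euclidean.1 (contDiff_deriv hγ)
  ((contDiff_norm_deriv hγ hreg).inv fun s => norm_ne_zero_iff.2 (hreg s)).smul
    (contDiff_plane_mk (hcoord 1) (hcoord 0).neg)

/-! ### Normal coordinates -/

/-- The normal coordinates `(s, r) ↦ γ(s) + r n(s)` along `γ`. -/
noncomputable def tubeMap (γ : ℝ → Plane) (p : ℝ × ℝ) : Plane := γ p.1 + p.2 • rightNormal γ p.1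

theorem tubeMap_zero (γ : ℝ → Plane) (s : ℝ) : tubeMap γ (s, 0) = γ s := by
  simp [tubeMap]

theorem contDiff_tubeMap (hγ : ContDiff ℝ 2 γ) (hreg : ∀ s, deriv γ s ≠ 0) :
    ContDiff ℝ 1 (tubeMap γ) :=
  ((hγ.of_le one_le_two).comp contDiff_fst).add
    (contDiff_snd.smul ((contDiff_rightNormal hγ hreg).comp contDiff_fst))

theorem fderiv_tubeMap_zero (hγ : ContDiff ℝ 2 γ) (hreg : ∀ s, deriv γ s ≠ 0) (s : ℝ) :
    fderiv ℝ (tubeMap γ) (s, 0) = frameEquiv (hreg s) := by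
  have hcurve : HasFDerivAt (fun p : ℝ × ℝ => γ p.1) _ (s, 0) :=
    HasFDerivAt.comp (g := γ) ((s, 0) : ℝ × ℝ)
      (hasDerivAt_of_contDiff_two hγ s).hasFDerivAt hasFDerivAt_fst
  have hnormal : HasFDerivAt (fun p : ℝ × ℝ => rightNormal γ p.1) _ (s, 0) :=
    HasFDerivAt.comp (g := rightNormal γ) ((s, 0) : ℝ × ℝ)
      ((contDiff_rightNormal hγ hreg).differentiable one_ne_zero s).hasFDerivAt hasFDerivAt_fst
  refine ((hcurve.add (hasFDerivAt_snd.smul hnormal)).congr_fderiv ?_).fderiv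
  ext <;> simp [frameEquiv_apply]

theorem hasStrictFDerivAt_tubeMap (hγ : ContDiff ℝ 2 γ) (hreg : ∀ s, deriv γ s ≠ 0) (s : ℝ) :
    HasStrictFDerivAt (tubeMap γ) (frameEquiv (hreg s) : (ℝ × ℝ) →L[ℝ] Plane) (s, 0) := by
  rw [← fderiv_tubeMap_zero hγ]
  exact (contDiff_tubeMap hγ hreg).contDiffAt.hasStrictFDerivAt one_ne_zero

end RegularCurve

/-! ### The tubular neighbourhood -/

theorem exists_injOn_prod_ball {X Y M : Type*} [TopologicalSpace X] [CompactSpace X]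
    [TopologicalSpace Y] [T2Space Y] [PseudoMetricSpace M] {Φ : X × M → Y} {c : M}
    (hΦ : Continuous Φ) (hinj : InjOn Φ (univ ×ˢ {c})) (hloc : ∀ x, ∃ u ∈ 𝓝 (x, c), InjOn Φ u) :
    ∃ δ > 0, InjOn Φ (univ ×ˢ Metric.ball c δ) := by
  obtain ⟨u, hu, hinju⟩ := hinj.exists_mem_nhdsSet (isCompact_univ.prod isCompact_singleton)
    (fun x _ => hΦ.continuousAt) fun p hp => by
      obtain ⟨x, rfl⟩ : ∃ x, p = (x, c) := ⟨p.1, Prod.ext rfl hp.2⟩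
      exact hloc x
  rw [isCompact_univ.nhdsSet_prod_eq isCompact_singleton, nhdsSet_univ, nhdsSet_singleton,
    mem_prod_iff] at hu
  obtain ⟨a, ha, b, hb, hab⟩ := hu
  obtain ⟨δ, hδ, hball⟩ := Metric.mem_nhds_iff.1 hb
  exact ⟨δ, hδ, hinju.mono ((prod_mono (mem_top.1 ha).ge hball).trans hab)⟩

theorem lift_injective_of_injOn_Ico {Y : Type*} {c : ℝ → Y} {ℓ : ℝ} (hℓ : 0 < ℓ)
    (hc : Function.Periodic c ℓ) (hinj : InjOn c (Ico 0 ℓ)) : Function.Injective hc.lift := by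
  have : Fact (0 < ℓ) := ⟨hℓ⟩
  have hrep : ∀ a : AddCircle ℓ, ∃ x ∈ Ico 0 ℓ, (x : AddCircle ℓ) = a := fun a => by
    have := AddCircle.coe_image_Ico_eq ℓ 0 ▸ mem_univ a
    rwa [zero_add] at this
  intro a b hab
  obtain ⟨x, hx, rfl⟩ := hrep a
  obtain ⟨y, hy, rfl⟩ := hrep b
  rw [hinj hx hy hab]

theorem exists_mem_nhds_injOn_tubeMap {γ : ℝ → Plane} (hγ : ContDiff ℝ 2 γ)
    (hreg : ∀ s, deriv γ s ≠ 0) (s : ℝ) : ∃ u ∈ 𝓝 ((s, 0) : ℝ × ℝ), InjOn (tubeMap γ) u :=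
  have hstrict := hasStrictFDerivAt_tubeMap hγ hreg s
  ⟨_, (hstrict.toOpenPartialHomeomorph _).open_source.mem_nhds
    hstrict.mem_toOpenPartialHomeomorph_source, (hstrict.toOpenPartialHomeomorph _).injOn⟩

theorem eventually_neg_iff_of_hasDerivWithinAt {h : ℝ → ℝ} {v : ℝ}
    (hh : HasDerivWithinAt h v (Ioi 0) 0) (h0 : h 0 = 0) (hv : v ≠ 0) :
    ∀ᶠ t in 𝓝[>] (0 : ℝ), (h t < 0 ↔ v < 0) := by
  have hslope : Tendsto (fun t => h t / t) (𝓝[>] 0) (𝓝 v) := by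
    simpa [slope_fun_def_field, h0] using
      (hasDerivWithinAt_iff_tendsto_slope' self_notMem_Ioi).1 hh
  rcases hv.lt_or_gt with hv | hv
  · filter_upwards [hslope.eventually_lt_const hv, self_mem_nhdsWithin] with t hlt (ht : 0 < t)
    simpa only [hv, iff_true] using neg_of_div_neg_left hlt ht.le
  · filter_upwards [hslope.eventually_const_lt hv, self_mem_nhdsWithin] with t hlt (ht : 0 < t)
    simpa only [hv.not_gt, iff_false] using ((div_pos_iff_of_pos_right ht).1 hlt).not_gt

namespace IsJordanRegion

variable {Ω : Set Plane} {γ : ℝ → Plane} {ℓ : ℝ}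

theorem image_Ioc (hΩ : IsJordanRegion Ω γ ℓ) : γ '' Ioc 0 ℓ = range γ := by
  simpa only [zero_add] using hΩ.periodic.image_Ioc hΩ.period_pos 0

theorem isCompact_range (hΩ : IsJordanRegion Ω γ ℓ) : IsCompact (range γ) := by
  rw [← hΩ.periodic.image_Icc hΩ.period_pos 0]
  exact isCompact_Icc.image hΩ.contDiff.continuous

theorem curve_mem_frontier (hΩ : IsJordanRegion Ω γ ℓ) (s : ℝ) : γ s ∈ frontier Ω :=
  hΩ.frontier_eq ▸ mem_range_self s

theorem exists_injective_tube (hΩ : IsJordanRegion Ω γ ℓ) :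
    ∃ δ > 0, ∀ s s' r r' : ℝ, |r| < δ → |r'| < δ → tubeMap γ (s, r) = tubeMap γ (s', r') →
      (s : AddCircle ℓ) = s' ∧ r = r' := by
  have : Fact (0 < ℓ) := ⟨hΩ.period_pos⟩
  have hnormal := periodic_rightNormal hΩ.periodic
  let Φ : AddCircle ℓ × ℝ → Plane := fun p => hΩ.periodic.lift p.1 + p.2 • hnormal.lift p.1
  have hΦ : Continuous Φ :=
    ((hΩ.contDiff.continuous.quotient_lift _).comp continuous_fst).add (continuous_snd.smul
      (((contDiff_rightNormal hΩ.contDiff hΩ.regular).continuous.quotient_lift _).comp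
        continuous_fst))
  have hinj : InjOn Φ (univ ×ˢ {0}) := by
    rintro ⟨a, r⟩ ⟨-, rfl : r = 0⟩ ⟨b, r'⟩ ⟨-, rfl : r' = 0⟩ hab
    simp only [Φ, zero_smul, add_zero] at hab
    rw [lift_injective_of_injOn_Ico hΩ.period_pos hΩ.periodic hΩ.simple hab]
  have hloc : ∀ a : AddCircle ℓ, ∃ u ∈ 𝓝 (a, (0 : ℝ)), InjOn Φ u := by
    intro a
    obtain ⟨s, rfl⟩ := QuotientAddGroup.mk_surjective a
    obtain ⟨u, hu, hinju⟩ := exists_mem_nhds_injOn_tubeMap hΩ.contDiff hΩ.regular s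
    refine ⟨Prod.map ((↑) : ℝ → AddCircle ℓ) id '' u,
      (QuotientAddGroup.isOpenMap_coe.prodMap IsOpenMap.id).image_mem_nhds hu, ?_⟩
    rintro _ ⟨p, hp, rfl⟩ _ ⟨q, hq, rfl⟩ hpq
    rw [hinju hp hq hpq]
  obtain ⟨δ, hδ, hΦinj⟩ := exists_injOn_prod_ball hΦ hinj hloc
  refine ⟨δ, hδ, fun s s' r r' hr hr' h => ?_⟩
  exact Prod.ext_iff.1 (@hΦinj ((s : AddCircle ℓ), r) ⟨mem_univ _, by simpa using hr⟩
    ((s' : AddCircle ℓ), r') ⟨mem_univ _, by simpa using hr'⟩ h)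

theorem tubeMap_mem_iff (hΩ : IsJordanRegion Ω γ ℓ) {δ : ℝ} (hδ : 0 < δ)
    (hoff : ∀ s r : ℝ, |r| < δ → r ≠ 0 → tubeMap γ (s, r) ∉ frontier Ω) {s r : ℝ} (hr : |r| < δ) :
    tubeMap γ (s, r) ∈ Ω ↔ r < 0 := by
  have hside : ∀ I ⊆ Ioo (-δ) δ, IsPreconnected I → 0 ∉ I → ∀ s r s' r', r ∈ I → r' ∈ I →
      tubeMap γ (s, r) ∈ Ω → tubeMap γ (s', r') ∈ Ω := by
    intro I hIδ hI hI0 s r s' r' hr hr' hmem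
    by_contra hmem'
    obtain ⟨-, ⟨⟨u, v⟩, ⟨-, hv⟩, rfl⟩, hfr⟩ := inter_frontier_nonempty_of_isPreconnected
      ((isPreconnected_univ.prod hI).image _
        (contDiff_tubeMap hΩ.contDiff hΩ.regular).continuous.continuousOn)
      ⟨_, mem_image_of_mem _ (mk_mem_prod (mem_univ s) hr), hmem⟩
      ⟨_, mem_image_of_mem _ (mk_mem_prod (mem_univ s') hr'), hmem'⟩
    exact hoff u v (abs_lt.2 (hIδ hv)) (ne_of_mem_of_not_mem hv hI0) hfr
  obtain ⟨ρ, ⟨hin, hout⟩, hρ⟩ := ((hΩ.outward 0).and (Ioo_mem_nhdsGT hδ)).exists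
  rw [abs_lt] at hr
  rcases lt_trichotomy r 0 with hr0 | rfl | hr0
  · refine iff_of_true (hside (Ioo (-δ) 0) (Ioo_subset_Ioo_right hδ.le) isPreconnected_Ioo
      (by simp) 0 (-ρ) s r ⟨neg_lt_neg hρ.2, neg_lt_zero.2 hρ.1⟩ ⟨hr.1, hr0⟩ ?_) hr0
    simpa [tubeMap, sub_eq_add_neg] using hin
  · refine iff_of_false (fun hmem => ?_) (lt_irrefl 0)
    rw [tubeMap_zero] at hmem
    exact (hΩ.isOpen.frontier_eq ▸ hΩ.curve_mem_frontier s).2 hmem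
  · exact iff_of_false (fun hmem => hout (hside (Ioo 0 δ) (Ioo_subset_Ioo_left (by linarith))
      isPreconnected_Ioo (by simp) s r 0 ρ ⟨hr0, hr.2⟩ hρ hmem)) hr0.not_gt

theorem exists_tube (hΩ : IsJordanRegion Ω γ ℓ) :
    ∃ δ > 0, InjOn (tubeMap γ) (Ioc 0 ℓ ×ˢ Ioo (-δ) δ) ∧
      ∀ s r : ℝ, |r| < δ → (tubeMap γ (s, r) ∈ Ω ↔ r < 0) := by
  have : Fact (0 < ℓ) := ⟨hΩ.period_pos⟩
  obtain ⟨δ, hδ, hinj⟩ := hΩ.exists_injective_tube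
  refine ⟨δ, hδ, ?_, fun s r hr => hΩ.tubeMap_mem_iff hδ (fun s r hr hr0 hmem => ?_) hr⟩
  · rintro ⟨s, r⟩ ⟨hs, hr⟩ ⟨s', r'⟩ ⟨hs', hr'⟩ h
    obtain ⟨hss', rfl⟩ := hinj s s' r r' (abs_lt.2 hr) (abs_lt.2 hr') h
    rw [AddCircle.coe_eq_coe_iff_of_mem_Ioc (a := 0) (by simpa using hs) (by simpa using hs')]
      at hss'
    rw [hss']
  · rw [hΩ.frontier_eq] at hmem
    obtain ⟨u, hu⟩ := hmem
    rw [← tubeMap_zero γ u] at hu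
    exact hr0 (hinj u s 0 r (by simpa using hδ) hr hu).2.symm

theorem exists_eq_tubeMap (hΩ : IsJordanRegion Ω γ ℓ) (x : Plane) :
    ∃ s ∈ Ioc 0 ℓ, ∃ r, |r| = Metric.infDist x (frontier Ω) ∧ x = tubeMap γ (s, r) := by
  obtain ⟨y, hy, hxy⟩ := hΩ.isCompact_range.exists_infDist_eq_dist (range_nonempty γ) x
  rw [← hΩ.image_Ioc] at hy
  obtain ⟨s, hs, rfl⟩ := hy
  have hmin : IsLocalMin (fun u => ‖x - γ u‖ ^ 2) s := Eventually.of_forall fun u => by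
    have := hxy ▸ Metric.infDist_le_dist_of_mem (x := x) (mem_range_self (f := γ) u)
    rw [dist_eq_norm, dist_eq_norm] at this
    exact pow_le_pow_left₀ (norm_nonneg _) this 2
  have horth : inner ℝ (x - γ s) (deriv γ s) = 0 := by
    have := hmin.hasDerivAt_eq_zero
      ((hasDerivAt_of_contDiff_two hΩ.contDiff s).const_sub x).norm_sq
    rw [inner_neg_right] at this
    linarith
  have hnormal := eq_tangential_add_normal (hΩ.regular s) (x - γ s)
  rw [horth, zero_div, zero_smul, zero_add] at hnormal
  refine ⟨s, hs, inner ℝ (x - γ s) (rightNormal γ s), ?_, by simp [tubeMap, hnormal]⟩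
  rw [hΩ.frontier_eq, hxy, dist_eq_norm, ← congrArg norm hnormal, norm_smul,
    norm_rightNormal (hΩ.regular s), mul_one, Real.norm_eq_abs]

theorem eventually_mem_iff (hΩ : IsJordanRegion Ω γ ℓ) {y : ℝ → Plane} {w : Plane} {s : ℝ}
    (hy : HasDerivWithinAt y w (Ioi 0) 0) (hy0 : y 0 = γ s)
    (hw : inner ℝ w (rightNormal γ s) ≠ 0) :
    ∀ᶠ t in 𝓝[>] (0 : ℝ), (y t ∈ Ω ↔ inner ℝ w (rightNormal γ s) < 0) := by
  obtain ⟨δ, hδ, -, hmem⟩ := hΩ.exists_tube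
  have hstrict := hasStrictFDerivAt_tubeMap hΩ.contDiff hΩ.regular s
  set Ψ := hstrict.localInverse (tubeMap γ) (frameEquiv (hΩ.regular s)) (s, 0)
  have hbase : tubeMap γ (s, 0) = y 0 := by rw [tubeMap_zero, hy0]
  have hΨ0 : Ψ (y 0) = (s, 0) := hbase ▸ hstrict.localInverse_apply_image
  have hΨ : HasFDerivAt Ψ ((frameEquiv (hΩ.regular s)).symm : Plane →L[ℝ] ℝ × ℝ) (y 0) :=
    hbase ▸ hstrict.to_localInverse.hasFDerivAt
  have hright : ∀ᶠ z in 𝓝 (y 0), tubeMap γ (Ψ z) = z := hbase ▸ hstrict.eventually_right_inverse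
  have hr : HasDerivWithinAt (fun t => (Ψ (y t)).2) (inner ℝ w (rightNormal γ s)) (Ioi 0) 0 := by
    rw [← frameEquiv_symm_apply_snd (hΩ.regular s)]
    exact hasFDerivAt_snd.comp_hasDerivWithinAt (0 : ℝ) (hΨ.comp_hasDerivWithinAt (0 : ℝ) hy)
  have hsmall : ∀ᶠ t in 𝓝[>] (0 : ℝ), |(Ψ (y t)).2| < δ :=
    hr.continuousWithinAt.tendsto.abs.eventually_lt_const (by simpa [hΨ0] using hδ)
  filter_upwards [hy.continuousWithinAt.eventually hright, hsmall,
    eventually_neg_iff_of_hasDerivWithinAt hr (by rw [hΨ0]) hw] with t hyt hrt hneg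
  rw [← hyt, hmem _ _ hrt, hneg]

end IsJordanRegion

/-! ### Integration over boundary layers -/

section ChangeOfVariables

variable {E F H : Type*} [NormedAddCommGroup E] [NormedSpace ℝ E] [FiniteDimensional ℝ E]
  [MeasurableSpace E] [BorelSpace E] {μ : Measure E} [μ.IsAddHaarMeasure]
  [NormedAddCommGroup F] [NormedSpace ℝ F] [MeasurableSpace F] [BorelSpace F] {ν : Measure F}
  [NormedAddCommGroup H] [NormedSpace ℝ H] {φ : E → F} {φ' : E → E →L[ℝ] F} {A : Set E}
  {e : F ≃L[ℝ] E}

theorem setIntegral_image_eq_of_measurePreserving (he : MeasurePreserving e ν μ)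
    (hA : MeasurableSet A) (hφ : ∀ x ∈ A, HasFDerivWithinAt φ (φ' x) A x) (hinj : InjOn φ A)
    (G : F → H) :
    ∫ y in φ '' A, G y ∂ν = ∫ x in A, |((e : F →L[ℝ] E).comp (φ' x)).det| • G (φ x) ∂μ := by
  have hcov := integral_image_eq_integral_abs_det_fderiv_smul μ hA
    (fun x hx => e.hasFDerivAt.comp_hasFDerivWithinAt x (hφ x hx))
    (e.injective.comp_injOn hinj) (G ∘ e.symm)
  rw [image_comp, he.setIntegral_image_emb e.toHomeomorph.measurableEmbedding] at hcov
  simpa using hcov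

theorem integrableOn_image_iff_of_measurePreserving (he : MeasurePreserving e ν μ)
    (hA : MeasurableSet A) (hφ : ∀ x ∈ A, HasFDerivWithinAt φ (φ' x) A x) (hinj : InjOn φ A)
    (G : F → H) :
    IntegrableOn G (φ '' A) ν ↔
      IntegrableOn (fun x => |((e : F →L[ℝ] E).comp (φ' x)).det| • G (φ x)) A μ := by
  have hcov := integrableOn_image_iff_integrableOn_abs_det_fderiv_smul μ hA
    (fun x hx => e.hasFDerivAt.comp_hasFDerivWithinAt x (hφ x hx))
    (e.injective.comp_injOn hinj) (G ∘ e.symm)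
  rw [image_comp, he.integrableOn_image e.toHomeomorph.measurableEmbedding] at hcov
  simpa [Function.comp_def] using hcov

end ChangeOfVariables

/-- The isomorphism of the Euclidean plane with `ℝ × ℝ` given by the coordinates; it preserves
the area, but not the norm. -/
noncomputable def planeCoord : Plane ≃L[ℝ] ℝ × ℝ :=
  (EuclideanSpace.equiv (Fin 2) ℝ).trans (ContinuousLinearEquiv.finTwoArrow ℝ ℝ)

theorem planeCoord_apply (x : Plane) : planeCoord x = (x 0, x 1) := rfl

theorem measurePreserving_planeCoord :
    MeasurePreserving planeCoord (volume : Measure Plane) volume :=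
  (volume_preserving_finTwoArrow ℝ).comp
    (EuclideanSpace.volume_preserving_symm_measurableEquiv_toLp (Fin 2))

theorem det_prod_eq (L : (ℝ × ℝ) →L[ℝ] ℝ × ℝ) :
    L.det = (L (1, 0)).1 * (L (0, 1)).2 - (L (0, 1)).1 * (L (1, 0)).2 := by
  rw [ContinuousLinearMap.det, ← LinearMap.det_toMatrix (Module.Basis.finTwoProd ℝ),
    Matrix.det_fin_two]
  simp [LinearMap.toMatrix_apply]

/-- The area distortion of the normal coordinates `tubeMap γ`: the absolute value of their
Jacobian determinant. -/
noncomputable def tubeJacobian (γ : ℝ → Plane) (p : ℝ × ℝ) : ℝ :=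
  |((planeCoord : Plane →L[ℝ] ℝ × ℝ).comp (fderiv ℝ (tubeMap γ) p)).det|

/-- The normal coordinates on the boundary layer of width `t`: the signed distance from the curve
is measured in units of `t`. -/
noncomputable def layerMap (γ : ℝ → Plane) (t : ℝ) (p : ℝ × ℝ) : Plane :=
  tubeMap γ (p.1, t * p.2)

section Layer

variable {γ : ℝ → Plane}

theorem continuous_tubeJacobian (hγ : ContDiff ℝ 2 γ) (hreg : ∀ s, deriv γ s ≠ 0) :
    Continuous (tubeJacobian γ) :=
  (ContinuousLinearMap.continuous_det.comp
    (continuous_const.clm_comp ((contDiff_tubeMap hγ hreg).continuous_fderiv one_ne_zero))).abs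

theorem tubeJacobian_zero (hγ : ContDiff ℝ 2 γ) (hreg : ∀ s, deriv γ s ≠ 0) (s : ℝ) :
    tubeJacobian γ (s, 0) = ‖deriv γ s‖ := by
  have hpos := norm_pos_iff.2 (hreg s)
  have hdet : ((planeCoord : Plane →L[ℝ] ℝ × ℝ).comp (fderiv ℝ (tubeMap γ) (s, 0))).det
      = -‖deriv γ s‖ := by
    rw [fderiv_tubeMap_zero hγ hreg, det_prod_eq]
    simp only [ContinuousLinearMap.comp_apply, ContinuousLinearEquiv.coe_coe, frameEquiv_apply,
      planeCoord_apply, one_smul, zero_smul, add_zero, zero_add, rightNormal_apply_zero,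
      rightNormal_apply_one]
    field_simp
    rw [norm_sq_plane]
    ring
  rw [tubeJacobian, hdet, abs_neg, abs_of_pos hpos]

theorem hasFDerivAt_layerMap (hγ : ContDiff ℝ 2 γ) (hreg : ∀ s, deriv γ s ≠ 0) (t : ℝ)
    (p : ℝ × ℝ) :
    HasFDerivAt (layerMap γ t) ((fderiv ℝ (tubeMap γ) (p.1, t * p.2)).comp
      ((ContinuousLinearMap.id ℝ ℝ).prodMap (t • ContinuousLinearMap.id ℝ ℝ))) p :=
  HasFDerivAt.comp (g := tubeMap γ) p
    ((contDiff_tubeMap hγ hreg).differentiable one_ne_zero _).hasFDerivAt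
    ((ContinuousLinearMap.id ℝ ℝ).prodMap (t • ContinuousLinearMap.id ℝ ℝ)).hasFDerivAt

theorem abs_det_fderiv_layerMap (γ : ℝ → Plane) {t : ℝ} (ht : 0 < t) (p : ℝ × ℝ) :
    |((planeCoord : Plane →L[ℝ] ℝ × ℝ).comp ((fderiv ℝ (tubeMap γ) (p.1, t * p.2)).comp
      ((ContinuousLinearMap.id ℝ ℝ).prodMap (t • ContinuousLinearMap.id ℝ ℝ)))).det| =
      t * tubeJacobian γ (p.1, t * p.2) := by
  have hscale :
      ((ContinuousLinearMap.id ℝ ℝ).prodMap (t • ContinuousLinearMap.id ℝ ℝ)).det = t := by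
    simp [det_prod_eq]
  rw [tubeJacobian, ← ContinuousLinearMap.comp_assoc, ContinuousLinearMap.det,
    ContinuousLinearMap.toLinearMap_comp, LinearMap.det_comp, abs_mul]
  rw [ContinuousLinearMap.det] at hscale
  rw [hscale, abs_of_pos ht, mul_comm, ContinuousLinearMap.det]

theorem mapsTo_mul_snd_Icc {S : Set ℝ} {C t δ : ℝ} (ht : 0 ≤ t) (hCt : t * C < δ) :
    MapsTo (fun p : ℝ × ℝ => (p.1, t * p.2)) (S ×ˢ Icc (-C) C) (S ×ˢ Ioo (-δ) δ) := by
  rintro ⟨s, ρ⟩ ⟨hs, hρ⟩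
  refine ⟨hs, abs_lt.1 ?_⟩
  rw [abs_mul, abs_of_nonneg ht]
  exact (mul_le_mul_of_nonneg_left (abs_le.2 hρ) ht).trans_lt hCt

theorem injOn_layerMap {S : Set ℝ} {δ C t : ℝ} (hinj : InjOn (tubeMap γ) (S ×ˢ Ioo (-δ) δ))
    (ht : 0 < t) (hCt : t * C < δ) : InjOn (layerMap γ t) (S ×ˢ Icc (-C) C) :=
  hinj.comp (fun _ _ _ _ hpq => Prod.ext (Prod.ext_iff.1 hpq).1
    (mul_left_cancel₀ ht.ne' (Prod.ext_iff.1 hpq).2)) (mapsTo_mul_snd_Icc ht.le hCt)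

theorem tendsto_tubeJacobian_layer (hγ : ContDiff ℝ 2 γ) (hreg : ∀ s, deriv γ s ≠ 0)
    (p : ℝ × ℝ) :
    Tendsto (fun t : ℝ => tubeJacobian γ (p.1, t * p.2)) (𝓝[>] 0) (𝓝 ‖deriv γ p.1‖) := by
  have hcont : Continuous fun t : ℝ => tubeJacobian γ (p.1, t * p.2) :=
    (continuous_tubeJacobian hγ hreg).comp (by fun_prop)
  simpa only [zero_mul, tubeJacobian_zero hγ hreg] using
    (hcont.tendsto 0).mono_left nhdsWithin_le_nhds

theorem exists_tubeJacobian_layer_le (hγ : ContDiff ℝ 2 γ) (hreg : ∀ s, deriv γ s ≠ 0)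
    {K : Set (ℝ × ℝ)} (hK : IsCompact K) :
    ∃ B, ∀ t ∈ Icc (0 : ℝ) 1, ∀ p ∈ K, ‖tubeJacobian γ (p.1, t * p.2)‖ ≤ B := by
  have hcont : Continuous fun q : ℝ × ℝ × ℝ => tubeJacobian γ (q.2.1, q.1 * q.2.2) :=
    (continuous_tubeJacobian hγ hreg).comp (by fun_prop)
  have hcompact : IsCompact (Icc (0 : ℝ) 1 ×ˢ K) := isCompact_Icc.prod hK
  obtain ⟨B, hB⟩ := hcompact.exists_bound_of_continuousOn hcont.continuousOn
  exact ⟨B, fun t ht p hp => hB (t, p) ⟨ht, hp⟩⟩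

variable {A : Set (ℝ × ℝ)} {t : ℝ}

theorem setIntegral_image_layerMap (hγ : ContDiff ℝ 2 γ) (hreg : ∀ s, deriv γ s ≠ 0)
    (ht : 0 < t) (hA : MeasurableSet A) (hinj : InjOn (layerMap γ t) A) (G : Plane → ℝ) :
    ∫ x in layerMap γ t '' A, G x =
      t * ∫ p in A, tubeJacobian γ (p.1, t * p.2) * G (layerMap γ t p) := by
  rw [setIntegral_image_eq_of_measurePreserving measurePreserving_planeCoord hA
    (fun p _ => (hasFDerivAt_layerMap hγ hreg t p).hasFDerivWithinAt) hinj]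
  simp only [abs_det_fderiv_layerMap γ ht, smul_eq_mul, mul_assoc, integral_const_mul]

theorem integrableOn_image_layerMap_iff (hγ : ContDiff ℝ 2 γ) (hreg : ∀ s, deriv γ s ≠ 0)
    (ht : 0 < t) (hA : MeasurableSet A) (hinj : InjOn (layerMap γ t) A) (G : Plane → ℝ) :
    IntegrableOn G (layerMap γ t '' A) ↔
      IntegrableOn (fun p => tubeJacobian γ (p.1, t * p.2) * G (layerMap γ t p)) A := by
  rw [integrableOn_image_iff_of_measurePreserving measurePreserving_planeCoord hA
    (fun p _ => (hasFDerivAt_layerMap hγ hreg t p).hasFDerivWithinAt) hinj]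
  simp only [abs_det_fderiv_layerMap γ ht, smul_eq_mul, mul_assoc]
  exact integrable_const_mul_iff (isUnit_iff_ne_zero.2 ht.ne') _

end Layer

theorem eventually_mul_lt (C : ℝ) {δ : ℝ} (hδ : 0 < δ) : ∀ᶠ t in 𝓝[>] (0 : ℝ), t * C < δ := by
  have hmul : Tendsto (fun t : ℝ => t * C) (𝓝[>] 0) (𝓝 0) := by
    simpa using ((continuous_mul_const C).tendsto 0).mono_left nhdsWithin_le_nhds
  exact hmul.eventually_lt_const hδ

theorem tendsto_inv_mul_integral_of_layer {γ : ℝ → Plane} {a b δ C M : ℝ}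
    {G : ℝ → Plane → ℝ} {k : ℝ × ℝ → ℝ} (hγ : ContDiff ℝ 2 γ) (hreg : ∀ s, deriv γ s ≠ 0)
    (hδ : 0 < δ) (hinj : InjOn (tubeMap γ) (Ioc a b ×ˢ Ioo (-δ) δ))
    (hint : ∀ᶠ t in 𝓝[>] 0, Integrable (G t))
    (hsupp : ∀ᶠ t in 𝓝[>] 0, ∀ x ∉ layerMap γ t '' (Ioc a b ×ˢ Icc (-C) C), G t x = 0)
    (hbound : ∀ᶠ t in 𝓝[>] 0, ∀ p ∈ Ioc a b ×ˢ Icc (-C) C, |G t (layerMap γ t p)| ≤ M)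
    (hlim : ∀ᵐ p, Tendsto (fun t => G t (layerMap γ t p)) (𝓝[>] 0) (𝓝 (k p))) :
    Tendsto (fun t => t⁻¹ * ∫ x, G t x) (𝓝[>] 0)
      (𝓝 (∫ p in Ioc a b ×ˢ Icc (-C) C, ‖deriv γ p.1‖ * k p)) := by
  set A := Ioc a b ×ˢ Icc (-C) C
  have hA : MeasurableSet A := measurableSet_Ioc.prod measurableSet_Icc
  have hAK : A ⊆ Icc a b ×ˢ Icc (-C) C := prod_mono_left Ioc_subset_Icc_self
  have hK : IsCompact (Icc a b ×ˢ Icc (-C) C) := isCompact_Icc.prod isCompact_Icc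
  obtain ⟨B, hB⟩ := exists_tubeJacobian_layer_le hγ hreg hK
  have hinjA : ∀ᶠ t in 𝓝[>] (0 : ℝ), InjOn (layerMap γ t) A := by
    filter_upwards [self_mem_nhdsWithin, eventually_mul_lt C hδ] with t ht htC
    exact injOn_layerMap hinj ht htC
  have hconv : Tendsto (fun t => ∫ p in A, tubeJacobian γ (p.1, t * p.2) * G t (layerMap γ t p))
      (𝓝[>] 0) (𝓝 (∫ p in A, ‖deriv γ p.1‖ * k p)) := by
    refine tendsto_integral_filter_of_dominated_convergence (fun _ => B * M) ?_ ?_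
      (integrableOn_const ((measure_mono hAK).trans_lt hK.measure_lt_top).ne) ?_
    · filter_upwards [self_mem_nhdsWithin, hinjA, hint] with t ht hinjt hGt
      exact ((integrableOn_image_layerMap_iff hγ hreg ht hA hinjt _).1
        hGt.integrableOn).aestronglyMeasurable
    · filter_upwards [Ioo_mem_nhdsGT one_pos, hbound] with t ht hM
      refine ae_restrict_of_forall_mem hA fun p hp => ?_
      rw [norm_mul]
      have hBp := hB t (Ioo_subset_Icc_self ht) p (hAK hp)
      exact mul_le_mul hBp (hM p hp) (norm_nonneg _) ((norm_nonneg _).trans hBp)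
    · filter_upwards [ae_restrict_of_ae hlim] with p hp
      exact (tendsto_tubeJacobian_layer hγ hreg p).mul hp
  refine hconv.congr' ?_
  filter_upwards [self_mem_nhdsWithin, hinjA, hsupp] with t (ht : 0 < t) hinjt hzero
  rw [← setIntegral_eq_integral_of_forall_compl_eq_zero hzero,
    setIntegral_image_layerMap hγ hreg ht hA hinjt, inv_mul_cancel_left₀ ht.ne']

/-! ### The transport theorem -/

theorem tendsto_indicator_of_eventually_mem_iff {α X M : Type*} [TopologicalSpace X]
    [TopologicalSpace M] [Zero M] {l : Filter α} {S : α → Set X} {D : Set X} {x : α → X} {x₀ : X}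
    {g : X → M} {p : Prop} [Decidable p] (hSD : ∀ᶠ t in l, S t ⊆ D) (hx : Tendsto x l (𝓝 x₀))
    (hg : ContinuousWithinAt g D x₀) (hp : ∀ᶠ t in l, (x t ∈ S t ↔ p)) :
    Tendsto (fun t => (S t).indicator g (x t)) l (𝓝 (if p then g x₀ else 0)) := by
  by_cases h : p
  · simp only [h, iff_true] at hp
    rw [if_pos h]
    refine (hg.tendsto.comp (tendsto_nhdsWithin_iff.2 ⟨hx, ?_⟩)).congr' ?_
    · filter_upwards [hp, hSD] with t hxt hSt using hSt hxt
    · filter_upwards [hp] with t hxt using (indicator_of_mem hxt g).symm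
  · simp only [h, iff_false] at hp
    rw [if_neg h]
    refine tendsto_const_nhds.congr' ?_
    filter_upwards [hp] with t hxt using (indicator_of_notMem hxt g).symm

theorem continuous_comp_of_forall_mem_closure {X Y Z : Type*} [TopologicalSpace X]
    [TopologicalSpace Y] [T3Space Y] [TopologicalSpace Z] {D : Set X} {g : X → Y} {c : Z → X}
    (hc : Continuous c) (hcD : ∀ z, c z ∈ closure D)
    (hg : ∀ z, ContinuousWithinAt g D (c z)) : Continuous fun z => g (c z) := by
  have hext : ContinuousOn (extendFrom D g) (range c) :=
    continuousOn_extendFrom (range_subset_iff.2 hcD) (forall_mem_range.2 fun z => ⟨_, hg z⟩)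
  simpa only [Function.comp_def, extendFrom_eq (hcD _) (hg _)] using
    hext.comp_continuous hc mem_range_self

theorem exists_forall_mem_thickening_norm_le {X F : Type*} [PseudoMetricSpace X]
    [SeminormedAddCommGroup F] {K D : Set X} {g : X → F} (hK : IsCompact K)
    (hg : ∀ x ∈ K, ContinuousWithinAt g D x) :
    ∃ δ > 0, ∃ M, ∀ x ∈ Metric.thickening δ K, ∀ S ⊆ D, ‖S.indicator g x‖ ≤ M := by
  obtain ⟨U, hKU, hU, hbdd⟩ :=
    Metric.exists_isOpen_isBounded_image_inter_of_isCompact_of_forall_continuousWithinAt hK hg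
  obtain ⟨δ, hδ, hδU⟩ := hK.exists_thickening_subset_open hU hKU
  obtain ⟨M, hM⟩ := hbdd.exists_norm_le
  refine ⟨δ, hδ, |M|, fun x hx S hS => ?_⟩
  by_cases hxS : x ∈ S
  · rw [indicator_of_mem hxS]
    exact (hM _ (mem_image_of_mem g ⟨hδU hx, hS hxS⟩)).trans (le_abs_self M)
  · rw [indicator_of_notMem hxS, norm_zero]
    exact abs_nonneg M

theorem setIntegral_Icc_lt {C v : ℝ} (hv : |v| ≤ C) (c : ℝ) :
    ∫ ρ in Icc (-C) C, (if ρ < v then c else 0) = (v + C) * c := by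
  obtain ⟨hv₁, hv₂⟩ := abs_le.1 hv
  have hIco : Icc (-C) C ∩ Iio v = Ico (-C) v := by
    ext ρ
    exact ⟨fun h => ⟨h.1.1, h.2⟩, fun h => ⟨⟨h.1, h.2.le.trans hv₂⟩, h.2⟩⟩
  calc ∫ ρ in Icc (-C) C, (if ρ < v then c else 0)
      = ∫ ρ in Icc (-C) C, (Iio v).indicator (fun _ => c) ρ := rfl
    _ = ∫ _ in Ico (-C) v, c := by rw [setIntegral_indicator measurableSet_Iio, hIco]
    _ = (v + C) * c := by
      rw [setIntegral_const, Real.volume_real_Ico_of_le hv₁, smul_eq_mul, sub_neg_eq_add]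

theorem setIntegral_prod_lt_sub_lt {a b C : ℝ} {c v : ℝ → ℝ} (hc : Continuous c)
    (hv : Continuous v) (hvC : ∀ s ∈ Ioc a b, |v s| ≤ C) :
    ∫ p in Ioc a b ×ˢ Icc (-C) C,
      ((if p.2 < v p.1 then c p.1 else 0) - if p.2 < 0 then c p.1 else 0) =
      ∫ s in Ioc a b, c s * v s := by
  have hintc : IntegrableOn (fun p : ℝ × ℝ => c p.1) (Ioc a b ×ˢ Icc (-C) C) :=
    ((hc.comp continuous_fst).continuousOn.integrableOn_compact
      (isCompact_Icc.prod isCompact_Icc)).mono_set (prod_mono_left Ioc_subset_Icc_self)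
  have hint : ∀ w : ℝ → ℝ, Continuous w → IntegrableOn
      (fun p : ℝ × ℝ => if p.2 < w p.1 then c p.1 else 0) (Ioc a b ×ˢ Icc (-C) C) := by
    intro w hw
    have hlt : MeasurableSet {p : ℝ × ℝ | p.2 < w p.1} :=
      measurableSet_lt measurable_snd (hw.measurable.comp measurable_fst)
    exact Integrable.indicator hintc hlt
  have hdiff := (hint v hv).sub (hint (fun _ => 0) continuous_const)
  rw [Measure.volume_eq_prod] at hdiff ⊢
  refine (setIntegral_prod _ hdiff).trans (setIntegral_congr_fun measurableSet_Ioc fun s hs => ?_)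
  have hslice : ∀ w : ℝ, IntegrableOn (fun ρ => if ρ < w then c s else 0) (Icc (-C) C) := fun w =>
    (integrable_const (c s)).indicator (s := Iio w) measurableSet_Iio
  have h0 : |(0 : ℝ)| ≤ C := by simpa using (abs_nonneg _).trans (hvC s hs)
  simp only [Pi.sub_apply]
  rw [integral_sub (hslice _) (hslice _), setIntegral_Icc_lt (hvC s hs), setIntegral_Icc_lt h0]
  ring

theorem ae_snd_ne {h : ℝ → ℝ} (hh : Continuous h) : ∀ᵐ p : ℝ × ℝ, p.2 ≠ h p.1 := by
  rw [Measure.volume_eq_prod,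
    Measure.ae_prod_iff_ae_ae (p := fun p => p.2 ≠ h p.1)
      (measurableSet_eq_fun measurable_snd (hh.measurable.comp measurable_fst)).compl]
  exact Eventually.of_forall fun s => Measure.ae_ne volume (h s)

section Transport

variable {D Ω : Set Plane} {γ : ℝ → Plane} {ℓ : ℝ} {T : ℝ → Plane ≃ Plane} {ε : ℝ} {g : Plane → ℝ}

theorem IsJordanRegion.continuous_comp (hΩ : IsJordanRegion Ω γ ℓ) (hΩD : Ω ⊆ D)
    (hg : ∀ x ∈ frontier Ω, ContinuousWithinAt g D x) : Continuous fun s => g (γ s) :=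
  continuous_comp_of_forall_mem_closure hΩ.contDiff.continuous
    (fun s => closure_mono hΩD (frontier_subset_closure (hΩ.curve_mem_frontier s)))
    fun s => hg _ (hΩ.curve_mem_frontier s)

theorem continuous_normalVelocity (hγ : ContDiff ℝ 2 γ) (hreg : ∀ s, deriv γ s ≠ 0)
    (hT : IsDeformation T ε) : Continuous (normalVelocity T ε γ) := by
  unfold normalVelocity
  rw [hT.eulerianVelocity_zero]
  exact (hT.contDiff_velocity_zero.continuous.comp hγ.continuous).inner
    (contDiff_rightNormal hγ hreg).continuous

theorem hasDerivWithinAt_layerMap (γ : ℝ → Plane) (s ρ : ℝ) :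
    HasDerivWithinAt (fun t => layerMap γ t (s, ρ)) (ρ • rightNormal γ s) (Ioi 0) 0 := by
  have hline := (((hasDerivWithinAt_id (0 : ℝ) (Ioi 0)).mul_const ρ).smul_const
    (rightNormal γ s)).const_add (γ s)
  rw [one_mul] at hline
  exact hline

theorem layerMap_zero (γ : ℝ → Plane) (s ρ : ℝ) : layerMap γ 0 (s, ρ) = γ s := by
  rw [layerMap, zero_mul, tubeMap_zero]

theorem inner_smul_rightNormal_self {s : ℝ} (h : deriv γ s ≠ 0) (ρ : ℝ) :
    inner ℝ (ρ • rightNormal γ s) (rightNormal γ s) = ρ := by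
  rw [real_inner_smul_left, real_inner_self_eq_norm_sq, norm_rightNormal h, one_pow, mul_one]

theorem eventually_layerMap_mem_iff (hΩ : IsJordanRegion Ω γ ℓ) {s ρ : ℝ} (hρ : ρ ≠ 0) :
    ∀ᶠ t in 𝓝[>] (0 : ℝ), (layerMap γ t (s, ρ) ∈ Ω ↔ ρ < 0) := by
  have hinner := inner_smul_rightNormal_self (hΩ.regular s) ρ
  have hmem := hΩ.eventually_mem_iff (hasDerivWithinAt_layerMap γ s ρ) (layerMap_zero γ s ρ)
  rw [hinner] at hmem
  exact hmem hρ

theorem eventually_layerMap_mem_image_iff (hΩ : IsJordanRegion Ω γ ℓ) (hT : IsDeformation T ε)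
    {s ρ : ℝ} (hρ : ρ ≠ normalVelocity T ε γ s) :
    ∀ᶠ t in 𝓝[>] (0 : ℝ), (layerMap γ t (s, ρ) ∈ T t '' Ω ↔ ρ < normalVelocity T ε γ s) := by
  have hback := hT.hasDerivWithinAt_symm (hasDerivWithinAt_layerMap γ s ρ)
  have hinner : inner ℝ (ρ • rightNormal γ s - lagrangianVelocity T ε 0 (γ s)) (rightNormal γ s)
      = ρ - normalVelocity T ε γ s := by
    rw [inner_sub_left, inner_smul_rightNormal_self (hΩ.regular s), normalVelocity,
      hT.eulerianVelocity_zero]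
  rw [layerMap_zero] at hback
  have hmem := hΩ.eventually_mem_iff hback (by rw [hT.coe_symm_zero, layerMap_zero, id])
  simp only [hinner, sub_neg] at hmem
  simpa only [Equiv.image_eq_preimage_symm, mem_preimage] using hmem (sub_ne_zero.2 hρ)

theorem exists_forall_mem_image_iff (hΩ : Bornology.IsBounded Ω) (hT : IsDeformation T ε) :
    ∃ C > 0, ∀ᶠ t in 𝓝[>] (0 : ℝ), ∀ x, C * t < Metric.infDist x (frontier Ω) →
      (x ∈ T t '' Ω ↔ x ∈ Ω) := by
  have hK : IsCompact (closure Ω) := hΩ.isCompact_closure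
  obtain ⟨C₁, hC₁, hforth⟩ := hT.exists_forall_norm_sub_le hK
  obtain ⟨C₂, -, hback⟩ := hT.exists_forall_norm_symm_sub_le hK
  refine ⟨max C₁ C₂, lt_max_of_lt_left hC₁, ?_⟩
  filter_upwards [self_mem_nhdsWithin, hforth, hback] with t (ht : 0 < t) hforth hback x hx
  have hfar : ∀ z ∈ frontier Ω, max C₁ C₂ * t < dist z x := fun z hz =>
    dist_comm z x ▸ hx.trans_le (Metric.infDist_le_dist_of_mem hz)
  constructor
  · rintro ⟨y, hy, rfl⟩
    by_contra hxΩ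
    obtain ⟨z, hz, -, hzx⟩ := exists_mem_frontier_dist_le hy hxΩ
    have := hforth y (subset_closure hy)
    rw [← dist_eq_norm'] at this
    nlinarith [hfar z hz, le_max_left C₁ C₂]
  · intro hxΩ
    rw [Equiv.image_eq_preimage_symm, mem_preimage]
    by_contra hy
    obtain ⟨z, hz, hzx, -⟩ := exists_mem_frontier_dist_le hxΩ hy
    have := hback x (subset_closure hxΩ)
    rw [← dist_eq_norm'] at this
    nlinarith [hfar z hz, le_max_right C₁ C₂]

theorem mem_image_layerMap (hΩ : IsJordanRegion Ω γ ℓ) {C t : ℝ} (ht : 0 < t) {x : Plane}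
    (hx : Metric.infDist x (frontier Ω) ≤ C * t) :
    x ∈ layerMap γ t '' (Ioc 0 ℓ ×ˢ Icc (-C) C) := by
  obtain ⟨s, hs, r, hr, rfl⟩ := hΩ.exists_eq_tubeMap x
  refine ⟨(s, r / t), ⟨hs, ?_⟩, by rw [layerMap, mul_div_cancel₀ _ ht.ne']⟩
  rw [mem_Icc, ← abs_le, abs_div, abs_of_pos ht, div_le_iff₀ ht, hr]
  exact hx

theorem layerMap_mem_thickening {t δ C : ℝ} {p : ℝ × ℝ} (hreg : deriv γ p.1 ≠ 0) (ht : 0 ≤ t)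
    (htC : t * C < δ) (hp : p.2 ∈ Icc (-C) C) :
    layerMap γ t p ∈ Metric.thickening δ (range γ) := by
  refine Metric.mem_thickening_iff.2 ⟨γ p.1, mem_range_self p.1, ?_⟩
  rw [layerMap, tubeMap, dist_self_add_left, norm_smul, norm_rightNormal hreg, mul_one,
    Real.norm_eq_abs, abs_mul, abs_of_nonneg ht]
  exact (mul_le_mul_of_nonneg_left (abs_le.2 hp) ht).trans_lt htC

theorem eventually_norm_indicator_layerMap_le (hΩ : IsJordanRegion Ω γ ℓ)
    (hg : ∀ x ∈ frontier Ω, ContinuousWithinAt g D x) (C : ℝ) :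
    ∃ M, ∀ᶠ t in 𝓝[>] (0 : ℝ), ∀ p : ℝ × ℝ, p.2 ∈ Icc (-C) C → ∀ S ⊆ D,
      ‖S.indicator g (layerMap γ t p)‖ ≤ M := by
  rw [hΩ.frontier_eq] at hg
  obtain ⟨δ, hδ, M, hM⟩ := exists_forall_mem_thickening_norm_le hΩ.isCompact_range hg
  refine ⟨M, ?_⟩
  filter_upwards [self_mem_nhdsWithin, eventually_mul_lt C hδ] with t (ht : 0 < t) htC p hp
  exact hM _ (layerMap_mem_thickening (hΩ.regular p.1) ht.le htC hp)

theorem IsDeformation.subset_of_forall_image_subset (hT : IsDeformation T ε)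
    (hTD : ∀ t ∈ Ico 0 ε, T t '' Ω ⊆ D) : Ω ⊆ D := by
  simpa only [hT.coe_zero, image_id] using hTD 0 hT.zero_mem

theorem IsDeformation.integrable_indicator_image (hT : IsDeformation T ε)
    (hTD : ∀ t ∈ Ico 0 ε, T t '' Ω ⊆ D) (hΩ : IsOpen Ω) (hgD : IntegrableOn g D) {t : ℝ}
    (ht : t ∈ Ico 0 ε) : Integrable ((T t '' Ω).indicator g) :=
  (integrable_indicator_iff (hT.isOpen_image ht hΩ).measurableSet).2 (hgD.mono_set (hTD t ht))

theorem IsDeformation.integrable_indicator (hT : IsDeformation T ε)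
    (hTD : ∀ t ∈ Ico 0 ε, T t '' Ω ⊆ D) (hΩ : IsOpen Ω) (hgD : IntegrableOn g D) :
    Integrable (Ω.indicator g) := by
  simpa only [hT.coe_zero, image_id] using
    hT.integrable_indicator_image hTD hΩ hgD hT.zero_mem

theorem tendsto_inv_mul_integral_indicator_sub (hΩ : IsJordanRegion Ω γ ℓ)
    (hT : IsDeformation T ε) (hTD : ∀ t ∈ Ico 0 ε, T t '' Ω ⊆ D) (hgD : IntegrableOn g D)
    (hg : ∀ x ∈ frontier Ω, ContinuousWithinAt g D x) {C : ℝ}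
    (hC : ∀ᶠ t in 𝓝[>] (0 : ℝ), ∀ x, C * t < Metric.infDist x (frontier Ω) →
      (x ∈ T t '' Ω ↔ x ∈ Ω)) :
    Tendsto (fun t => t⁻¹ * ∫ x, ((T t '' Ω).indicator g x - Ω.indicator g x)) (𝓝[>] 0)
      (𝓝 (∫ p in Ioc 0 ℓ ×ˢ Icc (-C) C, ‖deriv γ p.1‖ *
        ((if p.2 < normalVelocity T ε γ p.1 then g (γ p.1) else 0) -
          if p.2 < 0 then g (γ p.1) else 0))) := by
  obtain ⟨δ, hδ, hinj, -⟩ := hΩ.exists_tube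
  obtain ⟨M, hM⟩ := eventually_norm_indicator_layerMap_le hΩ hg C
  have hΩD := hT.subset_of_forall_image_subset hTD
  have hmaps : ∀ᶠ t in 𝓝[>] (0 : ℝ), T t '' Ω ⊆ D := hT.eventually_mem_Ico.mono hTD
  refine tendsto_inv_mul_integral_of_layer (M := M + M) hΩ.contDiff hΩ.regular hδ hinj ?_ ?_ ?_ ?_
  · filter_upwards [hT.eventually_mem_Ico, hmaps] with t ht _
    exact (hT.integrable_indicator_image hTD hΩ.isOpen hgD ht).sub
      (hT.integrable_indicator hTD hΩ.isOpen hgD)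
  · filter_upwards [self_mem_nhdsWithin, hC] with t ht hiff x hx
    have hiffx := hiff x (not_le.1 fun hle => hx (mem_image_layerMap hΩ ht hle))
    by_cases hxΩ : x ∈ Ω
    · rw [indicator_of_mem hxΩ, indicator_of_mem (hiffx.2 hxΩ), sub_self]
    · rw [indicator_of_notMem hxΩ, indicator_of_notMem (mt hiffx.1 hxΩ), sub_self]
  · filter_upwards [hM, hmaps] with t hMt htD p hp
    exact (norm_sub_le _ _).trans (add_le_add (hMt p hp.2 _ htD) (hMt p hp.2 _ hΩD))
  · filter_upwards [ae_snd_ne (continuous_normalVelocity hΩ.contDiff hΩ.regular hT),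
      ae_snd_ne (continuous_const (y := (0 : ℝ)))] with p hpv hp0
    have hlayer : Tendsto (fun t => layerMap γ t p) (𝓝[>] 0) (𝓝 (γ p.1)) :=
      layerMap_zero γ p.1 p.2 ▸ (hasDerivWithinAt_layerMap γ p.1 p.2).continuousWithinAt
    have hgp := hg _ (hΩ.curve_mem_frontier p.1)
    exact (tendsto_indicator_of_eventually_mem_iff hmaps hlayer hgp
      (eventually_layerMap_mem_image_iff hΩ hT hpv)).sub
        (tendsto_indicator_of_eventually_mem_iff (Eventually.of_forall fun _ => hΩD) hlayer hgp
          (eventually_layerMap_mem_iff hΩ hp0))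

theorem setIntegral_layer_eq_arcIntegral {C : ℝ} {c v : ℝ → ℝ} (hγ : ContDiff ℝ 1 γ)
    (hℓ : 0 ≤ ℓ) (hc : Continuous c) (hv : Continuous v) (hvC : ∀ s ∈ Ioc 0 ℓ, |v s| ≤ C) :
    ∫ p in Ioc 0 ℓ ×ˢ Icc (-C) C, ‖deriv γ p.1‖ *
        ((if p.2 < v p.1 then c p.1 else 0) - if p.2 < 0 then c p.1 else 0) =
      arcIntegral γ ℓ fun s => c s * v s := by
  have hweight : Continuous fun s => ‖deriv γ s‖ * c s := (hγ.continuous_deriv le_rfl).norm.mul hc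
  simp only [mul_sub, mul_ite, mul_zero]
  rw [setIntegral_prod_lt_sub_lt hweight hv hvC, arcIntegral, intervalIntegral.integral_of_le hℓ]
  refine setIntegral_congr_fun measurableSet_Ioc fun s _ => ?_
  ring

theorem hasDerivWithinAt_setIntegral_image (hΩ : IsJordanRegion Ω γ ℓ)
    (hT : IsDeformation T ε) (hTD : ∀ t ∈ Ico 0 ε, T t '' Ω ⊆ D) (hgD : IntegrableOn g D)
    (hg : ∀ x ∈ frontier Ω, ContinuousWithinAt g D x) :
    HasDerivWithinAt (fun t => ∫ x in T t '' Ω, g x)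
      (arcIntegral γ ℓ fun s => g (γ s) * normalVelocity T ε γ s) (Ioi 0) 0 := by
  obtain ⟨C, -, hC⟩ := exists_forall_mem_image_iff hΩ.isBounded hT
  have hv := continuous_normalVelocity hΩ.contDiff hΩ.regular hT
  obtain ⟨V, hV⟩ := (isCompact_Icc (a := 0) (b := ℓ)).exists_bound_of_continuousOn hv.continuousOn
  have hlim := tendsto_inv_mul_integral_indicator_sub (C := max C V) hΩ hT hTD hgD hg <| by
    filter_upwards [self_mem_nhdsWithin, hC] with t ht hiff x hx
    exact hiff x ((mul_le_mul_of_nonneg_right (le_max_left C V) (le_of_lt ht)).trans_lt hx)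
  have hgγ := hΩ.continuous_comp (hT.subset_of_forall_image_subset hTD) hg
  rw [setIntegral_layer_eq_arcIntegral (hΩ.contDiff.of_le one_le_two) hΩ.period_pos.le hgγ hv
    fun s hs => (hV s (Ioc_subset_Icc_self hs)).trans (le_max_right C V)] at hlim
  rw [hasDerivWithinAt_iff_tendsto_slope' self_notMem_Ioi]
  refine hlim.congr' ?_
  filter_upwards [hT.eventually_mem_Ico] with t ht
  rw [slope_def_module, sub_zero, hT.coe_zero, image_id, smul_eq_mul,
    integral_sub (hT.integrable_indicator_image hTD hΩ.isOpen hgD ht)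
      (hT.integrable_indicator hTD hΩ.isOpen hgD),
    integral_indicator (hT.isOpen_image ht hΩ.isOpen).measurableSet,
    integral_indicator hΩ.isOpen.measurableSet]

end Transport

/-! ### The length of a simple `C¹` arc -/

section Length

open scoped NNReal ENNReal

section Metric

variable {X : Type*} [MetricSpace X] [MeasurableSpace X] [BorelSpace X] {c : ℝ → X} {a b : ℝ}

theorem hausdorffMeasure_image_Ioc_le {K : ℝ≥0} (h : LipschitzOnWith K c (Ioc a b)) :
    μH[1] (c '' Ioc a b) ≤ ENNReal.ofReal (K * (b - a)) := by
  have hle := h.hausdorffMeasure_image_le zero_le_one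
  rwa [hausdorffMeasure_real, ENNReal.rpow_one, Real.volume_Ioc, ← ENNReal.ofReal_coe_nnreal,
    ← ENNReal.ofReal_mul K.coe_nonneg] at hle

theorem hausdorffMeasure_image_Ioc_ne_top {K : ℝ≥0} (h : LipschitzOnWith K c (Ioc a b)) :
    μH[1] (c '' Ioc a b) ≠ ∞ :=
  ((hausdorffMeasure_image_Ioc_le h).trans_lt ENNReal.ofReal_lt_top).ne

theorem measureReal_image_Ioc_le {K : ℝ≥0} (h : LipschitzOnWith K c (Ioc a b)) (hab : a ≤ b) :
    (μH[1] : Measure X).real (c '' Ioc a b) ≤ K * (b - a) :=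
  ENNReal.toReal_le_of_le_ofReal (mul_nonneg K.coe_nonneg (sub_nonneg.2 hab))
    (hausdorffMeasure_image_Ioc_le h)

theorem ofReal_le_hausdorffMeasure_image_Ioc {K : ℝ≥0}
    (h : AntilipschitzWith K ((Ioc a b).domRestrict c)) :
    ENNReal.ofReal (b - a) ≤ K * μH[1] (c '' Ioc a b) := by
  have hle := h.le_hausdorffMeasure_image zero_le_one univ
  rwa [image_univ, range_domRestrict, ENNReal.rpow_one,
    ← isometry_subtype_coe.hausdorffMeasure_image (Or.inl zero_le_one), image_univ,
    Subtype.range_coe, hausdorffMeasure_real, Real.volume_Ioc] at hle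

theorem le_measureReal_image_Ioc {m : ℝ} {K : ℝ≥0} (hK : LipschitzOnWith K c (Ioc a b))
    (hab : a ≤ b) (h : ∀ x ∈ Ioc a b, ∀ y ∈ Ioc a b, m * dist x y ≤ dist (c x) (c y)) :
    m * (b - a) ≤ (μH[1] : Measure X).real (c '' Ioc a b) := by
  rcases le_or_gt m 0 with hm | hm
  · exact (mul_nonpos_of_nonpos_of_nonneg hm (sub_nonneg.2 hab)).trans measureReal_nonneg
  have hanti : AntilipschitzWith ⟨m⁻¹, (inv_pos.2 hm).le⟩ ((Ioc a b).domRestrict c) :=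
    AntilipschitzWith.of_le_mul_dist fun x y => (le_inv_mul_iff₀ hm).2 (h x x.2 y y.2)
  have hle := ENNReal.toReal_mono
    (ENNReal.mul_ne_top ENNReal.coe_ne_top (hausdorffMeasure_image_Ioc_ne_top hK))
    (ofReal_le_hausdorffMeasure_image_Ioc hanti)
  rw [ENNReal.toReal_ofReal (sub_nonneg.2 hab), ENNReal.toReal_mul] at hle
  exact (le_inv_mul_iff₀ hm).1 hle

end Metric

variable {F : Type*} [NormedAddCommGroup F] [NormedSpace ℝ F] {c : ℝ → F} {a b : ℝ}

theorem eventually_forall_Ioc_dist_bounds {x : ℝ} {c' : F} (hc : HasStrictDerivAt c c' x) {κ : ℝ}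
    (hκ : 0 < κ) :
    ∀ᶠ y in 𝓝[>] x, ∀ u ∈ Ioc x y, ∀ v ∈ Ioc x y,
      (‖c'‖ - κ) * dist u v ≤ dist (c u) (c v) ∧ dist (c u) (c v) ≤ (‖c'‖ + κ) * dist u v := by
  have happrox : ∀ᶠ p in 𝓝 x ×ˢ 𝓝 x, ‖c p.1 - c p.2 - (p.1 - p.2) • c'‖ ≤ κ * ‖p.1 - p.2‖ := by
    rw [← nhds_prod_eq]
    simpa using (hasStrictDerivAt_iff_hasStrictFDerivAt.1 hc).isLittleO.def hκ
  obtain ⟨U, hU, happrox⟩ := eventually_prod_self_iff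
    (r := fun u v => ‖c u - c v - (u - v) • c'‖ ≤ κ * ‖u - v‖) |>.1 happrox
  obtain ⟨δ, hδ, hball⟩ := Metric.mem_nhds_iff.1 hU
  filter_upwards [Ioo_mem_nhdsGT (lt_add_of_pos_right x hδ)] with y hy u hu v hv
  have hmem : ∀ z ∈ Ioc x y, z ∈ U := fun z hz => hball <| by
    rw [Metric.mem_ball, Real.dist_eq, abs_of_pos (sub_pos.2 hz.1)]
    linarith [hz.2, hy.2]
  have herr := happrox u (hmem u hu) v (hmem v hv)
  have hlin : ‖(u - v) • c'‖ = ‖c'‖ * ‖u - v‖ := by rw [norm_smul, mul_comm]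
  have hlow := norm_sub_norm_le ((u - v) • c') (c u - c v)
  have hupp := norm_sub_norm_le (c u - c v) ((u - v) • c')
  rw [norm_sub_rev _ (c u - c v)] at hlow
  rw [dist_eq_norm, dist_eq_norm]
  constructor <;> linarith

theorem exists_lipschitzOnWith_Icc (hc : ContDiff ℝ 1 c) (a b : ℝ) :
    ∃ K, LipschitzOnWith K c (Icc a b) :=
  hc.locallyLipschitz.locallyLipschitzOn.exists_lipschitzOnWith_of_compact isCompact_Icc

variable [MeasurableSpace F] [BorelSpace F]

/-- The length of the arc `c (a, x]`, as a function of its endpoint. -/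
noncomputable def arcLength (c : ℝ → F) (a x : ℝ) : ℝ :=
  (μH[1] : Measure F).real (c '' Ioc a x)

theorem arcLength_sub (hc : ContDiff ℝ 1 c) (hinj : InjOn c (Ioc a b)) {x y : ℝ} (hx : a ≤ x)
    (hxy : x ≤ y) (hy : y ≤ b) :
    arcLength c a y - arcLength c a x = (μH[1] : Measure F).real (c '' Ioc x y) := by
  obtain ⟨K, hK⟩ := exists_lipschitzOnWith_Icc hc a b
  have hxy_sub : Ioc x y ⊆ Ioc a b := Ioc_subset_Ioc hx hy
  have hax_sub : Ioc a x ⊆ Ioc a b := Ioc_subset_Ioc_right (hxy.trans hy)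
  have hdisj : Disjoint (c '' Ioc a x) (c '' Ioc x y) :=
    disjoint_image_image fun u hu v hv huv =>
      (Ioc_disjoint_Ioc_of_le le_rfl).le_bot ⟨hu, hinj (hax_sub hu) (hxy_sub hv) huv ▸ hv⟩
  rw [arcLength, arcLength, ← Ioc_union_Ioc_eq_Ioc hx hxy, image_union,
    measureReal_union hdisj
      (measurableSet_Ioc.image_of_continuousOn_injOn hc.continuous.continuousOn
        (hinj.mono hxy_sub))
      (hausdorffMeasure_image_Ioc_ne_top (hK.mono (hax_sub.trans Ioc_subset_Icc_self)))
      (hausdorffMeasure_image_Ioc_ne_top (hK.mono (hxy_sub.trans Ioc_subset_Icc_self))),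
    add_sub_cancel_left]

theorem hasDerivWithinAt_arcLength (hc : ContDiff ℝ 1 c) (hinj : InjOn c (Ioc a b)) {x : ℝ}
    (hx : x ∈ Ico a b) : HasDerivWithinAt (arcLength c a) ‖deriv c x‖ (Ioi x) x := by
  rw [hasDerivWithinAt_iff_tendsto_slope' self_notMem_Ioi, Metric.tendsto_nhds]
  intro κ hκ
  filter_upwards [Ioo_mem_nhdsGT hx.2, eventually_forall_Ioc_dist_bounds
    (hc.contDiffAt.hasStrictDerivAt one_ne_zero) (half_pos hκ)] with y hy hbounds
  have hlip : LipschitzOnWith ⟨‖deriv c x‖ + κ / 2, by positivity⟩ c (Ioc x y) :=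
    LipschitzOnWith.of_dist_le_mul fun u hu v hv => (hbounds u hu v hv).2
  have hupp := measureReal_image_Ioc_le hlip hy.1.le
  have hlow := le_measureReal_image_Ioc hlip hy.1.le fun u hu v hv => (hbounds u hu v hv).1
  have hpos : 0 < y - x := sub_pos.2 hy.1
  rw [slope_def_field, arcLength_sub hc hinj hx.1 hy.1.le hy.2.le, Real.dist_eq]
  refine (abs_sub_le_iff.2 ⟨?_, ?_⟩).trans_lt (half_lt_self hκ)
  · rw [sub_le_iff_le_add', div_le_iff₀ hpos]
    exact hupp
  · rw [sub_le_comm, le_div_iff₀ hpos]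
    exact hlow

theorem continuousOn_arcLength (hc : ContDiff ℝ 1 c) (hinj : InjOn c (Ioc a b)) :
    ContinuousOn (arcLength c a) (Icc a b) := by
  obtain ⟨K, hK⟩ := exists_lipschitzOnWith_Icc hc a b
  have hmono : ∀ x ∈ Icc a b, ∀ y ∈ Icc a b, x ≤ y →
      dist (arcLength c a y) (arcLength c a x) ≤ K * dist y x := by
    intro x hx y hy hxy
    rw [Real.dist_eq, arcLength_sub hc hinj hx.1 hxy hy.2, abs_of_nonneg measureReal_nonneg,
      Real.dist_eq, abs_of_nonneg (sub_nonneg.2 hxy)]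
    exact measureReal_image_Ioc_le
      (hK.mono ((Ioc_subset_Ioc hx.1 hy.2).trans Ioc_subset_Icc_self)) hxy
  refine (LipschitzOnWith.of_dist_le_mul (K := K) fun x hx y hy => ?_).continuousOn
  rcases le_total x y with hxy | hyx
  · rw [dist_comm, dist_comm x y]
    exact hmono x hx y hy hxy
  · exact hmono y hy x hx hyx

theorem measureReal_image_Ioc_eq_integral_norm_deriv (hc : ContDiff ℝ 1 c)
    (hinj : InjOn c (Ioc a b)) (hab : a ≤ b) :
    (μH[1] : Measure F).real (c '' Ioc a b) = ∫ s in a..b, ‖deriv c s‖ := by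
  rw [intervalIntegral.integral_eq_sub_of_hasDeriv_right_of_le hab
    (continuousOn_arcLength hc hinj)
    (fun x hx => hasDerivWithinAt_arcLength hc hinj (Ioo_subset_Ico_self hx))
    ((hc.continuous_deriv le_rfl).norm.intervalIntegrable a b),
    arcLength_sub hc hinj le_rfl hab le_rfl]

end Length

/-! ### The first variation of the length -/

theorem hasDerivWithinAt_intervalIntegral_Ioi {φ : ℝ → ℝ → ℝ} {φ' B : ℝ → ℝ} {t₀ a b : ℝ}
    (hφ : ∀ᶠ t in 𝓝[>] t₀, IntervalIntegrable (φ t) volume a b)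
    (hφ₀ : IntervalIntegrable (φ t₀) volume a b) (hB : IntervalIntegrable B volume a b)
    (hlip : ∀ᶠ t in 𝓝[>] t₀, ∀ s ∈ uIoc a b, ‖φ t s - φ t₀ s‖ ≤ B s * (t - t₀))
    (hφ' : ∀ s ∈ uIoc a b, HasDerivWithinAt (fun t => φ t s) (φ' s) (Ioi t₀) t₀) :
    HasDerivWithinAt (fun t => ∫ s in a..b, φ t s) (∫ s in a..b, φ' s) (Ioi t₀) t₀ := by
  have hlim : Tendsto (fun t => ∫ s in a..b, slope (fun t => φ t s) t₀ t) (𝓝[>] t₀)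
      (𝓝 (∫ s in a..b, φ' s)) := by
    refine intervalIntegral.tendsto_integral_filter_of_dominated_convergence B ?_ ?_ hB ?_
    · filter_upwards [hφ] with t ht
      simp only [slope_def_field]
      exact (intervalIntegrable_iff.1 ((ht.sub hφ₀).div_const _)).aestronglyMeasurable
    · filter_upwards [self_mem_nhdsWithin, hlip] with t (ht : t₀ < t) hlip
      refine Eventually.of_forall fun s hs => ?_
      rw [slope_def_field, norm_div, Real.norm_of_nonneg (sub_nonneg.2 ht.le),
        div_le_iff₀ (sub_pos.2 ht)]
      exact hlip s hs
    · exact Eventually.of_forall fun s hs =>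
        (hasDerivWithinAt_iff_tendsto_slope' self_notMem_Ioi).1 (hφ' s hs)
  rw [hasDerivWithinAt_iff_tendsto_slope' self_notMem_Ioi]
  refine hlim.congr' ?_
  filter_upwards [hφ] with t ht
  simp only [slope_def_field]
  rw [intervalIntegral.integral_div, intervalIntegral.integral_sub ht hφ₀]

theorem hasDerivWithinAt_norm {F : Type*} [NormedAddCommGroup F] [InnerProductSpace ℝ F]
    {f : ℝ → F} {f' : F} {S : Set ℝ} {x : ℝ} (hf : HasDerivWithinAt f f' S x) (h : f x ≠ 0) :
    HasDerivWithinAt (fun t => ‖f t‖) (inner ℝ f' (f x) / ‖f x‖) S x := by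
  have hsqrt := hf.norm_sq.sqrt (pow_ne_zero 2 (norm_ne_zero_iff.2 h))
  simp only [Real.sqrt_sq (norm_nonneg _)] at hsqrt
  rwa [real_inner_comm, mul_div_mul_left _ _ two_ne_zero] at hsqrt

section LengthDerivative

variable {Ω : Set Plane} {γ : ℝ → Plane} {ℓ : ℝ} {T : ℝ → Plane ≃ Plane} {ε : ℝ}

theorem IsJordanRegion.injOn_Ioc (hΩ : IsJordanRegion Ω γ ℓ) : InjOn γ (Ioc 0 ℓ) := by
  have : Fact (0 < ℓ) := ⟨hΩ.period_pos⟩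
  intro x hx y hy hxy
  refine (AddCircle.coe_eq_coe_iff_of_mem_Ioc (a := 0) (by rwa [zero_add])
    (by rwa [zero_add])).1 (lift_injective_of_injOn_Ico hΩ.period_pos hΩ.periodic hΩ.simple ?_)
  exact hxy

theorem E₃_image (hΩ : IsJordanRegion Ω γ ℓ) (hT : IsDeformation T ε) {t : ℝ}
    (ht : t ∈ Ico 0 ε) :
    E₃ (T t '' Ω) = ∫ s in (0 : ℝ)..ℓ, ‖fderiv ℝ (T t) (γ s) (deriv γ s)‖ := by
  have hderiv : deriv (T t ∘ γ) = fun s => fderiv ℝ (T t) (γ s) (deriv γ s) := funext fun s =>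
    (((hT.contDiff t ht).differentiable one_ne_zero (γ s)).hasFDerivAt.comp_hasDerivAt s
      (hasDerivAt_of_contDiff_two hΩ.contDiff s)).deriv
  rw [E₃, hT.frontier_image ht, hΩ.frontier_eq, ← hΩ.image_Ioc, ← image_comp,
    measureReal_image_Ioc_eq_integral_norm_deriv
      ((hT.contDiff t ht).comp (hΩ.contDiff.of_le one_le_two))
      ((T t).injective.comp_injOn hΩ.injOn_Ioc) hΩ.period_pos.le, hderiv]

theorem IsDeformation.hasDerivWithinAt_fderiv_apply (hT : IsDeformation T ε) (x v : Plane) :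
    HasDerivWithinAt (fun t => fderiv ℝ (T t) x v) (fderiv ℝ (lagrangianVelocity T ε 0) x v)
      (Ioi 0) 0 := by
  rw [hasDerivWithinAt_iff_tendsto_slope' self_notMem_Ioi]
  have hlim := ((ContinuousLinearMap.apply ℝ Plane v).continuous.tendsto _).comp
    ((hT.tendstoUniformlyOn_inv_smul_fderiv_sub isCompact_singleton).tendsto_at (mem_singleton x))
  simpa [slope_fun_def, Function.comp_def, hT.coe_zero] using hlim

theorem hasDerivWithinAt_norm_fderiv_apply (hT : IsDeformation T ε) (x : Plane) {v : Plane}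
    (hv : v ≠ 0) :
    HasDerivWithinAt (fun t => ‖fderiv ℝ (T t) x v‖)
      (inner ℝ (fderiv ℝ (lagrangianVelocity T ε 0) x v) v / ‖v‖) (Ioi 0) 0 := by
  have h0 : fderiv ℝ (T 0) x v = v := by rw [hT.coe_zero, fderiv_id, ContinuousLinearMap.id_apply]
  have hnorm := hasDerivWithinAt_norm (hT.hasDerivWithinAt_fderiv_apply x v) (by rwa [h0])
  rwa [h0] at hnorm

theorem hasDerivWithinAt_E₃_image (hΩ : IsJordanRegion Ω γ ℓ) (hT : IsDeformation T ε) :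
    HasDerivWithinAt (fun t => E₃ (T t '' Ω))
      (∫ s in (0 : ℝ)..ℓ, inner ℝ (fderiv ℝ (lagrangianVelocity T ε 0) (γ s) (deriv γ s))
        (deriv γ s) / ‖deriv γ s‖) (Ioi 0) 0 := by
  have hγ' := (contDiff_deriv hΩ.contDiff).continuous
  have hint : ∀ t ∈ Ico 0 ε,
      IntervalIntegrable (fun s => ‖fderiv ℝ (T t) (γ s) (deriv γ s)‖) volume 0 ℓ := fun t ht =>
    ((((hT.contDiff t ht).continuous_fderiv one_ne_zero).comp hΩ.contDiff.continuous).clm_apply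
      hγ').norm.intervalIntegrable 0 ℓ
  obtain ⟨C, -, hC⟩ := hT.exists_forall_norm_fderiv_sub_le hΩ.isCompact_range
  have hderiv := hasDerivWithinAt_intervalIntegral_Ioi (B := fun s => C * ‖deriv γ s‖)
    (hT.eventually_mem_Ico.mono hint) (hint 0 hT.zero_mem)
    ((hγ'.norm.const_mul C).intervalIntegrable 0 ℓ) ?_
    fun s _ => hasDerivWithinAt_norm_fderiv_apply hT (γ s) (hΩ.regular s)
  · refine hderiv.congr_of_eventuallyEq ?_ (E₃_image hΩ hT hT.zero_mem)
    filter_upwards [hT.eventually_mem_Ico] with t ht using E₃_image hΩ hT ht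
  · filter_upwards [hC] with t hC s _
    have hop := ContinuousLinearMap.le_of_opNorm_le _ (hC (γ s) (mem_range_self s)) (deriv γ s)
    rw [hT.coe_zero, fderiv_id, sub_zero, mul_right_comm]
    exact (abs_norm_sub_norm_le _ _).trans hop

end LengthDerivative

section Frenet

variable {γ : ℝ → Plane} {ℓ : ℝ} {T : ℝ → Plane ≃ Plane} {ε : ℝ}

theorem hasDerivAt_unitTangent (hγ : ContDiff ℝ 2 γ) (hreg : ∀ s, deriv γ s ≠ 0) (s : ℝ) :
    HasDerivAt (fun u => ‖deriv γ u‖⁻¹ • deriv γ u)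
      (-(curvature γ s * ‖deriv γ s‖) • rightNormal γ s) s := by
  have hpos : ‖deriv γ s‖ ≠ 0 := norm_ne_zero_iff.2 (hreg s)
  have hderiv : HasDerivAt (deriv γ) (deriv (deriv γ) s) s :=
    ((contDiff_deriv hγ).differentiable one_ne_zero s).hasDerivAt
  have hspeed : HasDerivAt (fun u => ‖deriv γ u‖)
      (inner ℝ (deriv (deriv γ) s) (deriv γ s) / ‖deriv γ s‖) s := by
    rw [← hasDerivWithinAt_univ] at hderiv ⊢
    exact hasDerivWithinAt_norm hderiv (hreg s)
  refine ((hspeed.inv hpos).smul hderiv).congr_deriv ?_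
  ext i
  fin_cases i <;>
  · simp only [curvature, inner_plane, rightNormal_apply_zero, rightNormal_apply_one,
      PiLp.add_apply, PiLp.smul_apply, Pi.inv_apply, smul_eq_mul, Fin.zero_eta, Fin.mk_one]
    field_simp
    rw [norm_sq_plane (deriv γ s)]
    ring

theorem continuous_curvature (hγ : ContDiff ℝ 2 γ) (hreg : ∀ s, deriv γ s ≠ 0) :
    Continuous (curvature γ) := by
  have hγ' := contDiff_deriv hγ
  have hfst := fun i => (contDiff_euclidean.1 hγ' i).continuous
  have hsnd := fun i => (EuclideanSpace.proj (𝕜 := ℝ) i).continuous.comp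
    (hγ'.continuous_deriv le_rfl)
  exact (((hfst 0).mul (hsnd 1)).sub ((hfst 1).mul (hsnd 0))).div (hγ'.continuous.norm.pow 3)
    fun s => pow_ne_zero 3 (norm_ne_zero_iff.2 (hreg s))

/-- Integration by parts: the tangential component of the velocity has period `ℓ`, and Frenet's
equation turns the derivative of the unit tangent into the curvature. -/
theorem integral_inner_fderiv_velocity_deriv (hγ : ContDiff ℝ 2 γ) (hreg : ∀ s, deriv γ s ≠ 0)
    (hper : Function.Periodic γ ℓ) (hT : IsDeformation T ε) :
    ∫ s in (0 : ℝ)..ℓ, inner ℝ (fderiv ℝ (lagrangianVelocity T ε 0) (γ s) (deriv γ s))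
        (deriv γ s) / ‖deriv γ s‖ =
      arcIntegral γ ℓ fun s => curvature γ s * normalVelocity T ε γ s := by
  set W := lagrangianVelocity T ε 0
  have hW : ContDiff ℝ 1 W := hT.contDiff_velocity_zero
  have hγ' := (contDiff_deriv hγ).continuous
  have htan : Continuous fun s =>
      inner ℝ (fderiv ℝ W (γ s) (deriv γ s)) (deriv γ s) / ‖deriv γ s‖ :=
    ((((hW.continuous_fderiv one_ne_zero).comp hγ.continuous).clm_apply hγ').inner hγ').div
      hγ'.norm fun s => norm_ne_zero_iff.2 (hreg s)
  have hnor : Continuous fun s => curvature γ s * normalVelocity T ε γ s * ‖deriv γ s‖ :=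
    ((continuous_curvature hγ hreg).mul (continuous_normalVelocity hγ hreg hT)).mul hγ'.norm
  have hderiv : ∀ s, HasDerivAt (fun u => inner ℝ (W (γ u)) (‖deriv γ u‖⁻¹ • deriv γ u))
      (inner ℝ (fderiv ℝ W (γ s) (deriv γ s)) (deriv γ s) / ‖deriv γ s‖
        - curvature γ s * normalVelocity T ε γ s * ‖deriv γ s‖) s := by
    intro s
    have hWγ : HasDerivAt (fun u => W (γ u)) (fderiv ℝ W (γ s) (deriv γ s)) s :=
      HasFDerivAt.comp_hasDerivAt s (hW.differentiable one_ne_zero (γ s)).hasFDerivAt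
        (hasDerivAt_of_contDiff_two hγ s)
    refine (hWγ.inner ℝ (hasDerivAt_unitTangent hγ hreg s)).congr_deriv ?_
    rw [inner_smul_right, inner_smul_right, normalVelocity, hT.eulerianVelocity_zero]
    ring
  have hparts := intervalIntegral.integral_eq_sub_of_hasDerivAt (a := 0) (b := ℓ)
    (fun s _ => hderiv s) ((htan.sub hnor).intervalIntegrable 0 ℓ)
  rw [hper.eq, (periodic_deriv hper).eq, sub_self,
    intervalIntegral.integral_sub (htan.intervalIntegrable 0 ℓ) (hnor.intervalIntegrable 0 ℓ)]
    at hparts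
  exact sub_eq_zero.1 hparts

end Frenet

/-! ### Differentiation of the energy -/

section EulerianDerivative

variable {J J₁ J₂ : Set Plane → ℝ} {T : ℝ → Plane ≃ Plane} {ε : ℝ} {Ω : Set Plane} {d d₁ d₂ : ℝ}

theorem IsDeformation.hasEulerianDerivative_iff (hT : IsDeformation T ε) :
    HasEulerianDerivative J T Ω d ↔ HasDerivWithinAt (fun t => J (T t '' Ω)) d (Ioi 0) 0 := by
  rw [hasDerivWithinAt_iff_tendsto_slope' self_notMem_Ioi, HasEulerianDerivative]
  refine tendsto_congr fun t => ?_
  rw [slope_def_field, hT.coe_zero, image_id, sub_zero]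

theorem HasEulerianDerivative.add (h₁ : HasEulerianDerivative J₁ T Ω d₁)
    (h₂ : HasEulerianDerivative J₂ T Ω d₂) :
    HasEulerianDerivative (fun S => J₁ S + J₂ S) T Ω (d₁ + d₂) :=
  (Tendsto.add h₁ h₂).congr fun t => by ring

theorem HasEulerianDerivative.const_mul (c : ℝ) (h : HasEulerianDerivative J T Ω d) :
    HasEulerianDerivative (fun S => c * J S) T Ω (c * d) :=
  (Tendsto.const_mul c h).congr fun t => by ring

end EulerianDerivative

section ArcIntegral

variable {γ : ℝ → Plane} {ℓ : ℝ}

theorem arcIntegral_add {a b : ℝ → ℝ} (hγ : ContDiff ℝ 1 γ) (ha : Continuous a)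
    (hb : Continuous b) :
    arcIntegral γ ℓ (fun s => a s + b s) = arcIntegral γ ℓ a + arcIntegral γ ℓ b := by
  have hspeed := (hγ.continuous_deriv le_rfl).norm
  simp only [arcIntegral, add_mul]
  exact intervalIntegral.integral_add ((ha.mul hspeed).intervalIntegrable 0 ℓ)
    ((hb.mul hspeed).intervalIntegrable 0 ℓ)

theorem arcIntegral_const_mul (c : ℝ) (a : ℝ → ℝ) :
    arcIntegral γ ℓ (fun s => c * a s) = c * arcIntegral γ ℓ a := by
  simp only [arcIntegral, mul_assoc, intervalIntegral.integral_const_mul]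

theorem arcIntegral_quadratic_mul {h w : ℝ → ℝ} (hγ : ContDiff ℝ 1 γ) (hh : Continuous h)
    (hw : Continuous w) (a b c : ℝ) :
    arcIntegral γ ℓ (fun s => (a * h s ^ 2 + b * h s + c) * w s) =
      a * arcIntegral γ ℓ (fun s => h s ^ 2 * w s) + b * arcIntegral γ ℓ (fun s => h s * w s)
        + c * arcIntegral γ ℓ w := by
  simp only [add_mul, mul_assoc]
  rw [arcIntegral_add hγ (by fun_prop) (by fun_prop), arcIntegral_add hγ (by fun_prop)
    (by fun_prop), arcIntegral_const_mul, arcIntegral_const_mul, arcIntegral_const_mul]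

end ArcIntegral

section Variance

variable {f : Plane → ℝ}

theorem regionVariance_eq {S : Set Plane} (hS : volume S ≠ ⊤)
    (hf : MemLp f 2 (volume.restrict S)) :
    regionVariance f S = (∫ x in S, f x ^ 2) / volume.real S
      - ((∫ x in S, f x) / volume.real S) ^ 2 := by
  have : IsFiniteMeasure (volume.restrict S) := isFiniteMeasure_restrict.2 hS
  rcases eq_or_ne (volume.real S) 0 with hS₀ | hS₀
  · simp [regionVariance, hS₀]
  have hf₁ : Integrable f (volume.restrict S) := hf.integrable one_le_two
  have hf₂ : Integrable (fun x => f x ^ 2) (volume.restrict S) := hf.integrable_sq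
  have hsquare : ∫ x in S, (f x - mean f S) ^ 2 =
      (∫ x in S, f x ^ 2) - 2 * mean f S * (∫ x in S, f x) + mean f S ^ 2 * volume.real S := by
    have hexpand : ∀ x, (f x - mean f S) ^ 2 =
        (f x ^ 2 - 2 * mean f S * f x) + mean f S ^ 2 := fun x => by ring
    simp_rw [hexpand]
    rw [integral_add (by fun_prop) (integrable_const _),
      integral_sub hf₂ (hf₁.const_mul _), integral_const_mul, setIntegral_const, smul_eq_mul,
      mul_comm (volume.real S)]
  rw [regionVariance, hsquare, mean]
  field_simp
  ring

theorem hasDerivWithinAt_div_sub_sq_div {A I Q : ℝ → ℝ} {A' I' Q' : ℝ} {S : Set ℝ} {x : ℝ}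
    (hA : HasDerivWithinAt A A' S x) (hI : HasDerivWithinAt I I' S x)
    (hQ : HasDerivWithinAt Q Q' S x) (hx : A x ≠ 0) :
    HasDerivWithinAt (fun t => Q t / A t - (I t / A t) ^ 2)
      (1 / A x * Q' - 1 / A x ^ 2 * (Q x * A' + 2 * I x * I' - 2 / A x * I x ^ 2 * A')) S x := by
  refine ((hQ.div hA hx).sub ((hI.div hA hx).pow 2)).congr_deriv ?_
  simp only [Pi.div_apply, Nat.cast_ofNat, Nat.add_one_sub_one, pow_one]
  field_simp
  ring

theorem δE₁_eq_quadratic (f : Plane → ℝ) (Ω : Set Plane) (x : Plane) :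
    δE₁ f Ω x = 1 / volume.real Ω * f x ^ 2
      + -(2 / volume.real Ω ^ 2 * ∫ y in Ω, f y) * f x
      + -(1 / volume.real Ω ^ 2 * ((∫ y in Ω, f y ^ 2)
        - 2 / volume.real Ω * (∫ y in Ω, f y) ^ 2)) := by
  rw [δE₁]
  ring

theorem δE₂_eq_neg_δE₁ (f : Plane → ℝ) (D Ω : Set Plane) (x : Plane) :
    δE₂ f D Ω x = -δE₁ f (D \ Ω) x := by
  rw [δE₂, δE₁]
  ring

theorem continuous_δE₁ {c : ℝ → Plane} (hf : Continuous fun s => f (c s)) (S : Set Plane) :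
    Continuous fun s => δE₁ f S (c s) := by
  simp only [δE₁_eq_quadratic]
  exact (((hf.pow 2).const_mul _).add (hf.const_mul _)).add_const _

theorem continuous_δE₂ {c : ℝ → Plane} (hf : Continuous fun s => f (c s)) (D Ω : Set Plane) :
    Continuous fun s => δE₂ f D Ω (c s) := by
  simp only [δE₂_eq_neg_δE₁]
  exact (continuous_δE₁ hf (D \ Ω)).neg

/-- Only the area and the first two moments of `f` enter, so it suffices to know how the integrals
of `1`, `f` and `f ^ 2` over `S t` vary. -/
theorem hasDerivWithinAt_regionVariance {D Γ : Set Plane} {γ : ℝ → Plane} {ℓ : ℝ}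
    {S : ℝ → Set Plane} {w : ℝ → ℝ} (hDfin : volume D ≠ ⊤) (hf : MemLp f 2 (volume.restrict D))
    (hfΓ : ∀ x ∈ Γ, ContinuousWithinAt f D x) (hγ : ContDiff ℝ 1 γ)
    (hfγ : Continuous fun s => f (γ s)) (hw : Continuous w)
    (hSD : ∀ᶠ t in 𝓝[≥] 0, S t ⊆ D) (hS₀ : volume (S 0) ≠ 0)
    (hS : ∀ g : Plane → ℝ, IntegrableOn g D → (∀ x ∈ Γ, ContinuousWithinAt g D x) →
      HasDerivWithinAt (fun t => ∫ x in S t, g x) (arcIntegral γ ℓ fun s => g (γ s) * w s)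
        (Ioi 0) 0) :
    HasDerivWithinAt (fun t => regionVariance f (S t))
      (arcIntegral γ ℓ fun s => δE₁ f (S 0) (γ s) * w s) (Ioi 0) 0 := by
  have : IsFiniteMeasure (volume.restrict D) := isFiniteMeasure_restrict.2 hDfin
  have hS₀D : S 0 ⊆ D := hSD.self_of_nhdsWithin self_mem_Ici
  have harea : HasDerivWithinAt (fun t => volume.real (S t)) (arcIntegral γ ℓ w) (Ioi 0) 0 := by
    simpa using hS (fun _ => 1) (integrable_const 1) fun _ _ => continuousWithinAt_const
  have hderiv := hasDerivWithinAt_div_sub_sq_div harea (hS f (hf.integrable one_le_two) hfΓ)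
    (hS (fun x => f x ^ 2) hf.integrable_sq fun x hx => (hfΓ x hx).pow 2)
    ((measureReal_ne_zero_iff (measure_ne_top_of_subset hS₀D hDfin)).2 hS₀)
  have hvar : ∀ᶠ t in 𝓝[≥] 0, regionVariance f (S t) =
      (∫ x in S t, f x ^ 2) / volume.real (S t) - ((∫ x in S t, f x) / volume.real (S t)) ^ 2 := by
    filter_upwards [hSD] with t ht
    exact regionVariance_eq (measure_ne_top_of_subset ht hDfin)
      (hf.mono_measure (Measure.restrict_mono_set volume ht))
  refine (hderiv.congr_of_eventuallyEq (hvar.filter_mono (nhdsWithin_mono 0 Ioi_subset_Ici_self))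
    (hvar.self_of_nhdsWithin self_mem_Ici)).congr_deriv ?_
  simp only [δE₁_eq_quadratic]
  rw [arcIntegral_quadratic_mul hγ hfγ hw]
  ring

end Variance

section Energy

variable {D Ω : Set Plane} {f : Plane → ℝ} {γ : ℝ → Plane} {ℓ : ℝ} {T : ℝ → Plane ≃ Plane} {ε : ℝ}

theorem IsJordanRegion.nonempty (hΩ : IsJordanRegion Ω γ ℓ) : Ω.Nonempty :=
  let ⟨_, hmem, _⟩ := (hΩ.outward 0).exists
  ⟨_, hmem⟩

theorem hasEulerianDerivative_E₁ (hDfin : volume D ≠ ⊤) (hΩ : IsJordanRegion Ω γ ℓ)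
    (hf : MemLp f 2 (volume.restrict D)) (hfΓ : ∀ x ∈ frontier Ω, ContinuousWithinAt f D x)
    (hT : IsDeformation T ε) (hTD : ∀ t ∈ Ico 0 ε, T t '' Ω ⊆ D) :
    HasEulerianDerivative (E₁ f) T Ω
      (arcIntegral γ ℓ fun s => δE₁ f Ω (γ s) * normalVelocity T ε γ s) := by
  have hT₀ : T 0 '' Ω = Ω := by rw [hT.coe_zero, image_id]
  rw [hT.hasEulerianDerivative_iff]
  have hderiv := hasDerivWithinAt_regionVariance (S := fun t => T t '' Ω) hDfin hf hfΓ
    (hΩ.contDiff.of_le one_le_two)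
    (hΩ.continuous_comp (hT.subset_of_forall_image_subset hTD) hfΓ)
    (continuous_normalVelocity hΩ.contDiff hΩ.regular hT)
    (eventually_of_mem (Ico_mem_nhdsGE hT.pos) hTD)
    (by rw [hT₀]; exact (hΩ.isOpen.measure_pos volume hΩ.nonempty).ne')
    fun g hgD hg => hasDerivWithinAt_setIntegral_image hΩ hT hTD hgD hg
  rwa [hT₀] at hderiv

theorem hasDerivWithinAt_setIntegral_sdiff_image {g : Plane → ℝ} (hΩ : IsJordanRegion Ω γ ℓ)
    (hT : IsDeformation T ε) (hTD : ∀ t ∈ Ico 0 ε, T t '' Ω ⊆ D) (hgD : IntegrableOn g D)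
    (hg : ∀ x ∈ frontier Ω, ContinuousWithinAt g D x) :
    HasDerivWithinAt (fun t => ∫ x in D \ T t '' Ω, g x)
      (arcIntegral γ ℓ fun s => g (γ s) * -normalVelocity T ε γ s) (Ioi 0) 0 := by
  have hdiff : ∀ t ∈ Ico 0 ε, ∫ x in D \ T t '' Ω, g x =
      (∫ x in D, g x) - ∫ x in T t '' Ω, g x := fun t ht =>
    setIntegral_sdiff (hT.isOpen_image ht hΩ.isOpen).measurableSet hgD (hTD t ht)
  refine (((hasDerivWithinAt_setIntegral_image hΩ hT hTD hgD hg).const_sub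
    (∫ x in D, g x)).congr_of_eventuallyEq (hT.eventually_mem_Ico.mono hdiff)
    (hdiff 0 hT.zero_mem)).congr_deriv ?_
  simp only [← neg_one_mul (normalVelocity T ε γ _), mul_left_comm _ (-1 : ℝ)]
  rw [arcIntegral_const_mul, neg_one_mul]

theorem hasEulerianDerivative_E₂ (hDfin : volume D ≠ ⊤) (hΩ : IsJordanRegion Ω γ ℓ)
    (hΩc : volume (D \ Ω) ≠ 0) (hf : MemLp f 2 (volume.restrict D))
    (hfΓ : ∀ x ∈ frontier Ω, ContinuousWithinAt f D x)
    (hT : IsDeformation T ε) (hTD : ∀ t ∈ Ico 0 ε, T t '' Ω ⊆ D) :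
    HasEulerianDerivative (E₂ f D) T Ω
      (arcIntegral γ ℓ fun s => δE₂ f D Ω (γ s) * normalVelocity T ε γ s) := by
  have hT₀ : T 0 '' Ω = Ω := by rw [hT.coe_zero, image_id]
  rw [hT.hasEulerianDerivative_iff]
  have hderiv := hasDerivWithinAt_regionVariance (S := fun t => D \ T t '' Ω) hDfin hf hfΓ
    (hΩ.contDiff.of_le one_le_two)
    (hΩ.continuous_comp (hT.subset_of_forall_image_subset hTD) hfΓ)
    (continuous_normalVelocity hΩ.contDiff hΩ.regular hT).neg
    (Eventually.of_forall fun _ => sdiff_subset) (by rwa [hT₀])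
    fun g hgD hg => hasDerivWithinAt_setIntegral_sdiff_image hΩ hT hTD hgD hg
  simpa only [E₂, hT₀, δE₂_eq_neg_δE₁, Pi.neg_apply, mul_neg, neg_mul] using hderiv

theorem hasEulerianDerivative_E₃ (hΩ : IsJordanRegion Ω γ ℓ) (hT : IsDeformation T ε) :
    HasEulerianDerivative E₃ T Ω
      (arcIntegral γ ℓ fun s => curvature γ s * normalVelocity T ε γ s) := by
  rw [hT.hasEulerianDerivative_iff,
    ← integral_inner_fderiv_velocity_deriv hΩ.contDiff hΩ.regular hΩ.periodic hT]
  exact hasDerivWithinAt_E₃_image hΩ hT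

theorem continuous_δE (hγ : ContDiff ℝ 2 γ) (hreg : ∀ s, deriv γ s ≠ 0)
    (hfγ : Continuous fun s => f (γ s)) (D : Set Plane) (η : ℝ) (Ω : Set Plane) :
    Continuous (δE f D η Ω γ) :=
  ((continuous_δE₁ hfγ Ω).add (continuous_δE₂ hfγ D Ω)).add
    ((continuous_curvature hγ hreg).const_mul η)

theorem arcIntegral_δE_mul {w : ℝ → ℝ} (hγ : ContDiff ℝ 2 γ) (hreg : ∀ s, deriv γ s ≠ 0)
    (hfγ : Continuous fun s => f (γ s)) (hw : Continuous w) (D : Set Plane) (η : ℝ)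
    (Ω : Set Plane) :
    arcIntegral γ ℓ (fun s => δE f D η Ω γ s * w s) =
      arcIntegral γ ℓ (fun s => δE₁ f Ω (γ s) * w s)
        + arcIntegral γ ℓ (fun s => δE₂ f D Ω (γ s) * w s)
        + η * arcIntegral γ ℓ (fun s => curvature γ s * w s) := by
  have hγ₁ : ContDiff ℝ 1 γ := hγ.of_le one_le_two
  have h₁ := continuous_δE₁ hfγ Ω
  have h₂ := continuous_δE₂ hfγ D Ω
  have h₃ := continuous_curvature hγ hreg
  simp only [δE, add_mul, mul_assoc]
  rw [arcIntegral_add hγ₁ (by fun_prop) (by fun_prop), arcIntegral_add hγ₁ (by fun_prop)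
    (by fun_prop), arcIntegral_const_mul]

end Energy

end MumfordShah

open MumfordShah in
theorem mainTheorem1_general {D Ω : Set Plane} {f : Plane → ℝ} (η : ℝ) {γ : ℝ → Plane} {ℓ : ℝ}
    {T : ℝ → Plane ≃ Plane} {ε : ℝ} (hDfin : volume D ≠ ⊤) (hΩ : IsJordanRegion Ω γ ℓ)
    (hΩc : volume (D \ Ω) ≠ 0) (hf : MemLp f 2 (volume.restrict D))
    (hfΓ : ∀ x ∈ frontier Ω, ContinuousWithinAt f D x) (hT : IsDeformation T ε)
    (hTD : ∀ t ∈ Ico 0 ε, T t '' Ω ⊆ D) :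
    HasEulerianDerivative (E₁ f) T Ω
        (arcIntegral γ ℓ fun s => δE₁ f Ω (γ s) * normalVelocity T ε γ s) ∧
      HasEulerianDerivative (E₂ f D) T Ω
        (arcIntegral γ ℓ fun s => δE₂ f D Ω (γ s) * normalVelocity T ε γ s) ∧
      HasEulerianDerivative E₃ T Ω
        (arcIntegral γ ℓ fun s => curvature γ s * normalVelocity T ε γ s) ∧
      Continuous (δE f D η Ω γ) ∧
      HasEulerianDerivative (energy f D η) T Ω
        (arcIntegral γ ℓ fun s => δE f D η Ω γ s * normalVelocity T ε γ s) := by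
  have hfγ : Continuous fun s => f (γ s) :=
    hΩ.continuous_comp (hT.subset_of_forall_image_subset hTD) hfΓ
  have hv : Continuous (normalVelocity T ε γ) :=
    continuous_normalVelocity hΩ.contDiff hΩ.regular hT
  have h₁ := hasEulerianDerivative_E₁ hDfin hΩ hf hfΓ hT hTD
  have h₂ := hasEulerianDerivative_E₂ hDfin hΩ hΩc hf hfΓ hT hTD
  have h₃ := hasEulerianDerivative_E₃ hΩ hT
  refine ⟨h₁, h₂, h₃, continuous_δE hΩ.contDiff hΩ.regular hfγ D η Ω, ?_⟩
  rw [arcIntegral_δE_mul hΩ.contDiff hΩ.regular hfγ hv]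
  exact (h₁.add h₂).add (h₃.const_mul η)

theorem mainTheorem1
    (D Ω : Set MumfordShah.Plane) (f : MumfordShah.Plane → ℝ) (η : ℝ)
    (γ : ℝ → MumfordShah.Plane) (ℓ : ℝ)
    (T : ℝ → MumfordShah.Plane ≃ MumfordShah.Plane) (ε : ℝ)
    (hD : IsClosed D) (hDfin : volume D ≠ ⊤)
    (hΩ : MumfordShah.IsJordanRegion Ω γ ℓ)
    (hΩc : volume (D \ Ω) ≠ 0)
    (hf : MemLp f 2 (volume.restrict D))
    (hfΓ : ∀ x ∈ frontier Ω, ContinuousWithinAt f D x)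
    (hT : MumfordShah.IsDeformation T ε)
    (hTD : ∀ t ∈ Ico 0 ε, T t '' Ω ⊆ D) :
    MumfordShah.HasEulerianDerivative (MumfordShah.E₁ f) T Ω
        (MumfordShah.arcIntegral γ ℓ fun s =>
          MumfordShah.δE₁ f Ω (γ s) * MumfordShah.normalVelocity T ε γ s) ∧
      MumfordShah.HasEulerianDerivative (MumfordShah.E₂ f D) T Ω
        (MumfordShah.arcIntegral γ ℓ fun s =>
          MumfordShah.δE₂ f D Ω (γ s) * MumfordShah.normalVelocity T ε γ s) ∧
      MumfordShah.HasEulerianDerivative MumfordShah.E₃ T Ω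
        (MumfordShah.arcIntegral γ ℓ fun s =>
          MumfordShah.curvature γ s * MumfordShah.normalVelocity T ε γ s) ∧
      Continuous (MumfordShah.δE f D η Ω γ) ∧
      MumfordShah.HasEulerianDerivative (MumfordShah.energy f D η) T Ω
        (MumfordShah.arcIntegral γ ℓ fun s =>
          MumfordShah.δE f D η Ω γ s * MumfordShah.normalVelocity T ε γ s) :=
  mainTheorem1_general η hDfin hΩ hΩc hf hfΓ hT hTD
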